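/- \textbf{Setting.} Let $U,V,H,Z,W$ be real Hilbert spaces with continuous inclusions $V\subset Z$, $V\subset W$, let $(\Omega,\mathcal F,\mathbb P)$ be a probability space, and let $a_\omega$ be a random continuous bilinear form on $V$ (with $\omega\mapsto a_\omega(v,w)$ measurable), coercive for a.e. $\omega$, with solution operators $S^\omega,S^{\omega,\star}:V'\to V$, $a_\omega(S^\omega g,v)=\langle g,v\rangle=a_\omega(v,S^{\omega,\star}g)$ for all $v\in V$; assume $\|S^\omega g\|_V\le C_S(\omega)\|g\|_{V'}$ with $C_S\in L^q(\Omega)$ for all $q\in[1,\infty)$. Let $\mathcal B\in\mathcal L(U,Z')$, $\mathcal C\in\mathcal L(W,H)$, $y_d\in H$, $\nu>0$, and let $u^\star$ be the minimizer over $u\in U$ (no control constraints) of $\frac12\mathbb E\|\mathcal C S^\omega\mathcal B u-y_d\|_H^2+\frac\nu2\|u\|_U^2$. \emph{Discretization.} Let $d\ge1$, let $V_\ell\subset V$ ($\ell\ge0$) be subspaces with $\dim V_\ell=2^{d\ell}$, $h_\ell=2^{-\ell}$, and let $S_\ell^\omega,S_\ell^{\omega,\star}$ be the Galerkin solution operators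 on $V_\ell$. A randomized quadrature formula $\mathcal Q[f]=\sum_{j=1}^{N}\zeta_jf(\xi_j)$ has random nodes $\xi_j\in\Omega$ and positive (possibly random) weights summing up to one. Put $p^\omega(u)=S^{\omega,\star}\mathcal C^\star\Lambda_H(y_d-\mathcal CS^\omega\mathcal Bu)$ and $p^\omega_\ell(u)=S_\ell^{\omega,\star}\mathcal C^\star\Lambda_H(y_d-\mathcal CS_\ell^\omega\mathcal Bu)$, where $\Lambda_U,\Lambda_H$ are the Riesz isomorphisms. Let $u^\star_{\ell,\infty}$ and $u^\star_{\ell,k}$ be the minimizers over $U$ of $\frac12\mathbb E\|\mathcal CS_\ell\mathcal Bu-y_d\|_H^2+\frac\nu2\|u\|_U^2$ and $J_{\ell,k}(u)=\frac12\mathcal Q^k[\|\mathcal CS_\ell\mathcal Bu-y_d\|_H^2]+\frac\nu2\|u\|_U^2$. The multilevel quadrature approximation of level $L$ is $$u^{MQ(L)}=\tfrac1\nu\Lambda_U^{-1}\mathcal B^\star\Big(\mathcal Q^L[p_0(u^\star_{0,L})]+\sum_{\ell=1}^L\mathcal Q^{L-\ell}[p_\ell(u^\star_{\ell,L-\ell})-p_{\ell-1}(u^\star_{\ell-1,L-\ell})]\Big),$$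 and its cost $W_{ML}$ is the total cost of minimizing $J_{0,L}$ and, for $1\le\ell\le L$, $J_{\ell-1,L-\ell}$ and $J_{\ell,L-\ell}$. \emph{Assumptions.} (Q) For each $q\in[2,\infty)$ a normed space $H_q(\Omega;Z)$ of integrable functions and a constant $\widetilde C_q$ are fixed. A sequence $(\mathcal Q^k)_{k\ge0}$, where $\mathcal Q^k$ has $N_k$ nodes, is called admissible for $\eta>0$ if the $\mathcal Q^k$ are unbiased, statistically independent, and $\|\mathbb E[f]-\mathcal Q^k[f]\|_{L^q(Z)}\le\widetilde C_qN_k^{-\eta}\|f\|_{H_q(\Omega;Z)}$ for all $q\in[2,\infty)$, $k\ge0$, $f\in H_q(\Omega;Z)$. (F) For a.e. $\omega$ and all $\ell,u,h$, $\|(S^\omega-S^\omega_\ell)\mathcal Bu\|_W\le C_a(\omega)h_\ell^{\alpha_W}\|u\|_U$ and $\|(S^{\omega,\star}-S_\ell^{\omega,\star})\mathcal C^\star\Lambda_Hh\|_Z\le C_a^\star(\omega)h_\ell^{\alpha_Z}\|h\|_H$, with $\alpha_W,\alpha_Z>0$ and $C_a,C_a^\star\in L^q(\Omega)$ for all $q\in[1,\infty)$.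 (M) There are $\bar q\in(2,\infty)$, $\widetilde\alpha>0$ and constants $C_{H,q}$ such that, for all $q\in[2,\bar q]$, $\ell\ge0$ and $u\in U$, $p(u),p_\ell(u)\in H_q(\Omega;Z)$ and $\|p(u^\star)-p_\ell(u^\star_{\ell,\infty})\|_{H_q(\Omega;Z)}\le C_{H,q}h_\ell^{\widetilde\alpha}(\|u^\star\|_U+\|y_d\|_H)$. (C) The cost of minimizing the functional on level $\ell$ with an $N$-point quadrature is proportional to $\dim(V_\ell)N$ (bounded above and below by positive multiples). Set $\alpha=\min(\alpha_W,\alpha_Z)$ and $\beta=\min(\alpha,\widetilde\alpha)$. \textbf{Theorem (Complexity of the multilevel quadrature approximation).} Let $\eta\in(0,\infty)$. For all sufficiently large constants $C_1,C_3>0$ (the thresholds not depending on the quadrature formulae), the following holds. (i) For every admissible sequence and every $L\ge1$, $$\mathbb E\|u^\star-u^{MQ(L)}\|_U^2\le2C_1^2h_L^{2\alpha}+C_3^2L\sum_{\ell=0}^Lh_\ell^{2\beta}N_{L-\ell}^{-2\eta}.$$ (ii) For $\varepsilon\in(0,\frac12]$ let $L=\left\lceil\frac1\alpha\log_2(2C_1\varepsilon^{-1})\right\rceil$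 and, for $0\le\ell\le L$, $$\widehat N_\ell=\left\lceil\Big(\sqrt{2LC_3^2}\,\varepsilon^{-1}\Big)^{\frac1\eta}h_\ell^{\frac{2\beta}{2\eta+1}}(\dim V_\ell)^{-\frac1{2\eta+1}}\Big(\sum_{j=0}^Lh_j^{\frac{2\beta}{2\eta+1}}(\dim V_j)^{\frac{2\eta}{2\eta+1}}\Big)^{\frac1{2\eta}}\right\rceil .$$ For every admissible sequence in which the quadrature $\mathcal Q^{L-\ell}$ used on spatial level $\ell$ has $\widehat N_\ell$ nodes ($0\le\ell\le L$), the multilevel approximation achieves $\mathbb E\|u^\star-u^{MQ(L)}\|_U^2\le\varepsilon^2$ at a cost $$W_{ML}(\varepsilon)\sim\begin{cases}\varepsilon^{-\frac d\alpha}+\varepsilon^{-\frac1\eta}|\log_2\varepsilon^{-1}|^{\frac1{2\eta}}&\beta>\eta d,\\ \varepsilon^{-\frac d\alpha}+\varepsilon^{-\frac1\eta}|\log_2\varepsilon^{-1}|^{1+\frac1\eta}&\beta=\eta d,\\ \varepsilon^{-\frac d\alpha}+\varepsilon^{-\frac1\eta-\frac{2\eta d-2\beta}{2\eta\alpha}}|\log_2\varepsilon^{-1}|^{\frac1{2\eta}}&\beta<\eta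 d,\end{cases}$$ where $\sim$ means upper and lower bounds up to positive constants independent of $\varepsilon$ and of the quadrature formulae. -/

import Mathlib

open MeasureTheory ProbabilityTheory

/-! ### The random optimal control problem -/

/-- Data of the linear-quadratic control problem
`min_u (1/2) E ‖C y - y_d‖² + (ν/2) ‖u‖²` subject to `a_ω(y_ω, v) = ⟨B u, v⟩` for all `v ∈ V`.
The inclusions `V ⊂ Z` and `V ⊂ W` are continuous; `B` maps `U` to the dual of `Z`, and the
observation operator `C` is continuous on `W`. There are no control constraints. -/
structure ControlProblem (Ω U V H Z W : Type*)
    [NormedAddCommGroup U] [InnerProductSpace ℝ U] [NormedAddCommGroup V] [InnerProductSpace ℝ V]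
    [NormedAddCommGroup H] [InnerProductSpace ℝ H] [NormedAddCommGroup Z] [InnerProductSpace ℝ Z]
    [NormedAddCommGroup W] [InnerProductSpace ℝ W] where
  /-- the inclusion of `V` in `Z` -/
  inclZ : V →L[ℝ] Z
  inclZ_injective : Function.Injective inclZ
  /-- the inclusion of `V` in `W` -/
  inclW : V →L[ℝ] W
  inclW_injective : Function.Injective inclW
  /-- the random bilinear form -/
  a : Ω → V →L[ℝ] V →L[ℝ] ℝ
  /-- the control operator -/
  B : U →L[ℝ] StrongDual ℝ Z
  /-- the observation operator -/
  C : W →L[ℝ] H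
  /-- the target state -/
  yd : H
  /-- the regularization parameter -/
  ν : ℝ
  ν_pos : 0 < ν

open Classical in
/-- The Galerkin solution: the element `y ∈ K` with `b(y, v) = ⟨g, v⟩` for all `v ∈ K`
(unique if `b` is coercive; `0` if there is none). `K = ⊤` gives the exact solution. -/
noncomputable def galerkinSolution {V : Type*} [NormedAddCommGroup V] [InnerProductSpace ℝ V]
    (b : V →L[ℝ] V →L[ℝ] ℝ) (K : Submodule ℝ V) (g : StrongDual ℝ V) : V :=
  if h : ∃ y ∈ K, ∀ v ∈ K, b y v = g v then h.choose else 0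

open Classical in
/-- A minimizer of a functional (unique for the strictly convex functionals below). -/
noncomputable def argminimizer {U : Type*} [Zero U] (J : U → ℝ) : U :=
  if h : ∃ u, ∀ w, J u ≤ J w then h.choose else 0

/-! ### Randomized quadrature -/

/-- A randomized quadrature formula on `Ω` with `n` nodes, with randomness in `Θ`, and with
positive weights that sum up to one. -/
structure RandomizedQuadrature (Ω Θ : Type*) [MeasurableSpace Ω] [MeasurableSpace Θ] where
  n : ℕ
  node : Fin n → Θ → Ω
  weight : Fin n → Θ → ℝ
  measurable_node : ∀ j, Measurable (node j)
  measurable_weight : ∀ j, Measurable (weight j)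
  weight_pos : ∀ j θ, 0 < weight j θ
  sum_weight : ∀ θ, ∑ j, weight j θ = 1

namespace RandomizedQuadrature

variable {Ω Θ : Type*} [MeasurableSpace Ω] [MeasurableSpace Θ]

/-- `𝒬[f] = ∑ⱼ ζⱼ f(ξⱼ)` for the sample `θ`. -/
noncomputable def apply {E : Type*} [AddCommGroup E] [Module ℝ E]
    (Q : RandomizedQuadrature Ω Θ) (θ : Θ) (f : Ω → E) : E :=
  ∑ j, Q.weight j θ • f (Q.node j θ)

/-- `E[𝒬[X]] = E[X]` for every integrable random variable `X`. -/
def IsUnbiased (Q : RandomizedQuadrature Ω Θ) (μ : Measure Ω) (ρ : Measure Θ) : Prop :=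
  ∀ X : Ω → ℝ, Integrable X μ →
    Integrable (fun θ => Q.apply θ X) ρ ∧ ∫ θ, Q.apply θ X ∂ρ = ∫ ω, X ω ∂μ

end RandomizedQuadrature

/-- A vector space of integrable functions `Ω → Z` with a norm (a seminorm on functions, so that
functions that agree almost everywhere may be identified). -/
structure IntegrandSpace {Ω : Type*} [MeasurableSpace Ω] (μ : Measure Ω) (Z : Type*)
    [NormedAddCommGroup Z] [NormedSpace ℝ Z] where
  carrier : Submodule ℝ (Ω → Z)
  integrable : ∀ f ∈ carrier, Integrable f μ
  seminorm : Seminorm ℝ carrier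

/-- The assumption on the quadrature formulae `𝒬⁰, 𝒬¹, …`: they are unbiased and statistically
independent, and `‖E[f] - 𝒬ᵏ[f]‖_{L^q} ≤ Cq(q) γₖ ‖f‖_{H_q}` for all `q ∈ [2, ∞)`, `k`, and
`f ∈ H_q`. -/
structure QuadratureAssumption {Ω Θ Z : Type*} [MeasurableSpace Ω] [MeasurableSpace Θ]
    [NormedAddCommGroup Z] [NormedSpace ℝ Z] (μ : Measure Ω) (ρ : Measure Θ)
    (Hq : ℝ → IntegrandSpace μ Z) (Cq : ℝ → ℝ) (γ : ℕ → ℝ)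
    (Q : ℕ → RandomizedQuadrature Ω Θ) : Prop where
  unbiased : ∀ k, (Q k).IsUnbiased μ ρ
  indep : iIndepFun (fun k θ => fun j : Fin (Q k).n => ((Q k).node j θ, (Q k).weight j θ)) ρ
  error_le : ∀ q : ℝ, 2 ≤ q → ∀ k, ∀ f : (Hq q).carrier,
    eLpNorm (fun θ => ∫ ω, (f : Ω → Z) ω ∂μ - (Q k).apply θ (f : Ω → Z)) (ENNReal.ofReal q) ρ ≤
      ENNReal.ofReal (Cq q * γ k * (Hq q).seminorm f)

/-- The mesh size `h_ℓ = 2^{-ℓ}`. -/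
noncomputable def meshSize (l : ℕ) : ℝ := (2 : ℝ)⁻¹ ^ l

namespace ControlProblem

variable {Ω U V H Z W : Type*}
  [NormedAddCommGroup U] [InnerProductSpace ℝ U] [NormedAddCommGroup V] [InnerProductSpace ℝ V]
  [NormedAddCommGroup H] [InnerProductSpace ℝ H] [NormedAddCommGroup Z] [InnerProductSpace ℝ Z]
  [NormedAddCommGroup W] [InnerProductSpace ℝ W]

/-- The functional `B u`, restricted to `V`. -/
noncomputable def source (P : ControlProblem Ω U V H Z W) (u : U) : StrongDual ℝ V :=
  (P.B u).comp P.inclZ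

/-- The functional `C* Λ_H h : v ↦ (h, C v)_H` on `V`. -/
noncomputable def obsSource (P : ControlProblem Ω U V H Z W) (h : H) : StrongDual ℝ V :=
  (innerSL ℝ h).comp (P.C.comp P.inclW)

/-- `S_K^ω g` for a subspace `K` of `V`; `K = ⊤` gives `S^ω`. -/
noncomputable def S (P : ControlProblem Ω U V H Z W) (K : Submodule ℝ V) (ω : Ω)
    (g : StrongDual ℝ V) : V :=
  galerkinSolution (P.a ω) K g

/-- `S_K^{ω,*} g`: the element `p ∈ K` with `a_ω(v, p) = ⟨g, v⟩` for all `v ∈ K`. -/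
noncomputable def Sadj (P : ControlProblem Ω U V H Z W) (K : Submodule ℝ V) (ω : Ω)
    (g : StrongDual ℝ V) : V :=
  galerkinSolution (P.a ω).flip K g

/-- The observation `C S_K^ω (B u)`. -/
noncomputable def observation (P : ControlProblem Ω U V H Z W) (K : Submodule ℝ V) (ω : Ω)
    (u : U) : H :=
  P.C (P.inclW (P.S K ω (P.source u)))

/-- The adjoint variable `p_K^ω(u) = S_K^{ω,*}(C* Λ_H (y_d - C S_K^ω (B u)))`, as an element
of `Z`. -/
noncomputable def p (P : ControlProblem Ω U V H Z W) (K : Submodule ℝ V) (u : U) (ω : Ω) : Z :=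
  P.inclZ (P.Sadj K ω (P.obsSource (P.yd - P.observation K ω u)))

/-- The minimizer of `(1/2) E ‖C S_K B u - y_d‖² + (ν/2) ‖u‖²`. For `K = ⊤` it is `u⋆`, for
`K = V_ℓ` it is the semi-discrete control `u⋆_{ℓ,∞}`. -/
noncomputable def optControl [MeasurableSpace Ω] (P : ControlProblem Ω U V H Z W)
    (μ : Measure Ω) (K : Submodule ℝ V) : U :=
  argminimizer fun u =>
    1 / 2 * ∫ ω, ‖P.observation K ω u - P.yd‖ ^ 2 ∂μ + P.ν / 2 * ‖u‖ ^ 2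

/-- The minimizer of `(1/2) 𝒬[‖C S_K B u - y_d‖²] + (ν/2) ‖u‖²` for the sample `θ`; for `K = V_ℓ`
and `𝒬 = 𝒬ᵏ` it is `u⋆_{ℓ,k}`. -/
noncomputable def quadControl {Θ : Type*} [MeasurableSpace Ω] [MeasurableSpace Θ]
    (P : ControlProblem Ω U V H Z W) (K : Submodule ℝ V) (Q : RandomizedQuadrature Ω Θ)
    (θ : Θ) : U :=
  argminimizer fun u =>
    1 / 2 * Q.apply θ (fun ω => ‖P.observation K ω u - P.yd‖ ^ 2) + P.ν / 2 * ‖u‖ ^ 2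

/-- `Λ_U⁻¹ B* z`, the element of `U` that represents `w ↦ ⟨B w, z⟩`. -/
noncomputable def rieszBadj [CompleteSpace U] (P : ControlProblem Ω U V H Z W) (z : Z) : U :=
  (InnerProductSpace.toDual ℝ U).symm (P.B.flip z)

/-- `𝒬[p_K(u⋆_{K,𝒬})]`: the quadrature of the adjoint variable at the discrete optimal control. -/
noncomputable def quadAdjoint {Θ : Type*} [MeasurableSpace Ω] [MeasurableSpace Θ]
    (P : ControlProblem Ω U V H Z W) (K : Submodule ℝ V) (Q : RandomizedQuadrature Ω Θ)
    (θ : Θ) : Z :=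
  Q.apply θ (P.p K (P.quadControl K Q θ))

/-- The multilevel quadrature approximation of level `L`,
`(1/ν) Λ_U⁻¹ B* (𝒬^L[p_0(u_{0,L})]
  + ∑_{ℓ=1}^L 𝒬^{L-ℓ}[p_ℓ(u_{ℓ,L-ℓ}) - p_{ℓ-1}(u_{ℓ-1,L-ℓ})])`. -/
noncomputable def multilevelControl [CompleteSpace U] {Θ : Type*} [MeasurableSpace Ω]
    [MeasurableSpace Θ] (P : ControlProblem Ω U V H Z W) (Vh : ℕ → Submodule ℝ V)
    (Q : ℕ → RandomizedQuadrature Ω Θ) (L : ℕ) (θ : Θ) : U :=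
  (1 / P.ν) • P.rieszBadj (P.quadAdjoint (Vh 0) (Q L) θ +
    ∑ l ∈ Finset.Icc 1 L, (P.quadAdjoint (Vh l) (Q (L - l)) θ -
      P.quadAdjoint (Vh (l - 1)) (Q (L - l)) θ))

/-- Standing assumptions on the random PDE: the form is (weakly) measurable in `ω` and almost
surely coercive, and the solution operator has a continuity constant in every `L^q`,
`q ∈ [1, ∞)`. -/
structure WellPosed [MeasurableSpace Ω] (P : ControlProblem Ω U V H Z W) (μ : Measure Ω) :
    Prop where
  measurable_form : ∀ v w : V, AEMeasurable (fun ω => P.a ω v w) μ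
  coercive : ∀ᵐ ω ∂μ, IsCoercive (P.a ω)
  stable : ∃ CS : Ω → ℝ, (∀ q : ℝ, 1 ≤ q → MemLp CS (ENNReal.ofReal q) μ) ∧
    ∀ᵐ ω ∂μ, ∀ g : StrongDual ℝ V, ‖P.S ⊤ ω g‖ ≤ CS ω * ‖g‖

/-- The assumption on the finite element approximations, with rates `αW` and `αZ`. -/
structure FEMAssumption [MeasurableSpace Ω] (P : ControlProblem Ω U V H Z W) (μ : Measure Ω)
    (Vh : ℕ → Submodule ℝ V) (αW αZ : ℝ) : Prop where
  forward : ∃ Ca : Ω → ℝ, (∀ q : ℝ, 1 ≤ q → MemLp Ca (ENNReal.ofReal q) μ) ∧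
    ∀ᵐ ω ∂μ, ∀ (l : ℕ) (u : U),
      ‖P.inclW (P.S ⊤ ω (P.source u) - P.S (Vh l) ω (P.source u))‖ ≤
        Ca ω * meshSize l ^ αW * ‖u‖
  adjoint : ∃ Ca' : Ω → ℝ, (∀ q : ℝ, 1 ≤ q → MemLp Ca' (ENNReal.ofReal q) μ) ∧
    ∀ᵐ ω ∂μ, ∀ (l : ℕ) (h : H),
      ‖P.inclZ (P.Sadj ⊤ ω (P.obsSource h) - P.Sadj (Vh l) ω (P.obsSource h))‖ ≤
        Ca' ω * meshSize l ^ αZ * ‖h‖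

/-- The mixed-regularity assumption, with rate `α'`, for `q ∈ [2, qbar]`. -/
structure MixedRegularity [MeasurableSpace Ω] (P : ControlProblem Ω U V H Z W) (μ : Measure Ω)
    (Vh : ℕ → Submodule ℝ V) (Hq : ℝ → IntegrandSpace μ Z) (CH : ℝ → ℝ) (qbar α' : ℝ) :
    Prop where
  mem_exact : ∀ (u : U) (q : ℝ), 2 ≤ q → q ≤ qbar → P.p ⊤ u ∈ (Hq q).carrier
  mem_discrete : ∀ (u : U) (q : ℝ), 2 ≤ q → q ≤ qbar → ∀ l, P.p (Vh l) u ∈ (Hq q).carrier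
  norm_le : ∀ q : ℝ, 2 ≤ q → q ≤ qbar → ∀ l, ∀ f : (Hq q).carrier,
    (f : Ω → Z) = P.p ⊤ (P.optControl μ ⊤) - P.p (Vh l) (P.optControl μ (Vh l)) →
      (Hq q).seminorm f ≤ CH q * meshSize l ^ α' * (‖P.optControl μ ⊤‖ + ‖P.yd‖)

end ControlProblem

/-! ### Complexity -/

/-- The work of the multilevel algorithm of level `L`: it solves the discrete problem `(0, L)`,
and, for `1 ≤ ℓ ≤ L`, the discrete problems `(ℓ - 1, L - ℓ)` and `(ℓ, L - ℓ)`. Here `cost ℓ N` is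
the cost of minimizing the functional of spatial level `ℓ` with an `N`-point quadrature, and
`n k` is the number of points of `𝒬ᵏ`. -/
noncomputable def multilevelWork (cost : ℕ → ℕ → ℝ) (n : ℕ → ℕ) (L : ℕ) : ℝ :=
  cost 0 (n L) + ∑ l ∈ Finset.Icc 1 L, (cost (l - 1) (n (L - l)) + cost l (n (L - l)))

/-- `L = ⌈(1/α) log₂(2 C₁ ε⁻¹)⌉`. -/
noncomputable def maxLevel (α C₁ ε : ℝ) : ℕ := ⌈1 / α * Real.logb 2 (2 * C₁ * ε⁻¹)⌉₊

/-- The number of quadrature points used on the spatial level `l`, for dimensions `D j` of the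
spaces `V_j`:
`⌈(√(2 L C₃²) ε⁻¹)^{1/η} h_l^{2β/(2η+1)} D_l^{-1/(2η+1)}
  (∑_{j ≤ L} h_j^{2β/(2η+1)} D_j^{2η/(2η+1)})^{1/(2η)}⌉`. -/
noncomputable def numPoints (D : ℕ → ℕ) (β η C₃ ε : ℝ) (L l : ℕ) : ℕ :=
  ⌈(Real.sqrt (2 * L * C₃ ^ 2) * ε⁻¹) ^ (1 / η) * meshSize l ^ (2 * β / (2 * η + 1)) *
    (D l : ℝ) ^ (-1 / (2 * η + 1)) *
    (∑ j ∈ Finset.range (L + 1),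
      meshSize j ^ (2 * β / (2 * η + 1)) * (D j : ℝ) ^ (2 * η / (2 * η + 1))) ^ (1 / (2 * η))⌉₊

open Classical in
/-- The asymptotic cost, in the three cases `β > η d`, `β = η d` and `β < η d`. -/
noncomputable def complexityRate (d : ℕ) (α β η ε : ℝ) : ℝ :=
  if η * d < β then
    ε ^ (-(d / α)) + ε ^ (-(1 / η)) * |Real.logb 2 ε⁻¹| ^ (1 / (2 * η))
  else if β = η * d then
    ε ^ (-(d / α)) + ε ^ (-(1 / η)) * |Real.logb 2 ε⁻¹| ^ (1 + 1 / η)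
  else
    ε ^ (-(d / α)) + ε ^ (-(1 / η) - (2 * η * d - 2 * β) / (2 * η * α)) *
      |Real.logb 2 ε⁻¹| ^ (1 / (2 * η))

/-!
The proof rests on the optimality conditions. For almost every sample, the control `u_{ℓ,k}` that
minimizes the discrete functional of spatial level `ℓ` with the quadrature formula `𝒬ᵏ` satisfies
`ν u_{ℓ,k} = Λ_U⁻¹ B* 𝒬ᵏ[p_ℓ(u_{ℓ,k})]` (`ControlProblem.quadControl_optimality`). Hence the
multilevel approximation is a telescoping sum of discrete optimal controls
(`ControlProblem.multilevelControl_eq`), and with `e_{ℓ,k} = u_{ℓ,∞} - u_{ℓ,k}`,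
`u⋆ - u^{MQ(L)} = (u⋆ - u_{L,∞}) + e_{0,L} + ∑_{ℓ=1}^L (e_{ℓ,L-ℓ} - e_{ℓ-1,L-ℓ})`.

All three kinds of terms are estimated by coercivity. The Hessian
`A_ℓ : u ↦ Λ_U⁻¹ B* S_ℓ^* C* Λ_H C S_ℓ B u` is positive semidefinite for every realization and so is
its mean with respect to the probability measure or to a quadrature formula with positive
weights. Therefore `ν ‖x‖ ≤ ‖r‖` whenever `ν x + 𝒬[A_ℓ] x = r`
(`mul_norm_le_of_smul_eq_sub`). The residual of `u⋆ - u_{L,∞}` is a finite element error of the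
adjoint variable, the one of `e_{ℓ,k}` is the quadrature error of `p_ℓ(u_{ℓ,∞})`, and the one of
`e_{ℓ,k} - e_{ℓ-1,k}` is the quadrature error of `p_ℓ(u_{ℓ,∞}) - p_{ℓ-1}(u_{ℓ-1,∞})` plus
`𝒬ᵏ[A_{ℓ-1} - A_ℓ] e_{ℓ-1,k}`. The last product is of order `h_ℓ^α N_k^{-η}` in mean square:
Hölder's inequality separates the factors, which is possible since `e_{ℓ-1,k}` is controlled in
`L^q̄` with `q̄ > 2`, and the discretization constant, averaged by an unbiased quadrature formula,
keeps all its moments by Jensen's inequality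
(`RandomizedQuadrature.IsUnbiased.eLpNorm_apply_le`). This gives
`ControlProblem.exists_multilevel_error_le`.

No separability is assumed. Measurability comes from the adjoint variables, which belong to spaces
of integrable functions: the tracking functional is an affine function of them
(`ControlProblem.norm_observation_sub_sq`), and the discrete controls lie in fixed
finite-dimensional spaces (`ControlProblem.aestronglyMeasurable_quadControl`).

For the complexity, the level `L` makes the first part of the error bound at most `ε²/2`, and the
numbers of points do the same for the second part, at minimal work
(`stochastic_error_numPoints_le`). The work is then
comparable to `∑ dim V_ℓ + (√(2LC₃²)/ε)^{1/η} Σ^{1+1/(2η)}`, where `Σ` is a geometric sum with ratio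
`2^{(2ηd-2β)/(2η+1)}`; it is bounded, equal to `L + 1`, or dominated by its last term according to
the sign of `ηd - β`, which yields the three cases (`comparable_complexityRate`).
-/

/-! ### Galerkin solutions -/

section Galerkin

variable {V : Type*} [NormedAddCommGroup V] [InnerProductSpace ℝ V]

theorem galerkinSolution_mem (b : V →L[ℝ] V →L[ℝ] ℝ) (K : Submodule ℝ V) (g : StrongDual ℝ V) :
    galerkinSolution b K g ∈ K := by
  unfold galerkinSolution
  split_ifs with h
  · exact h.choose_spec.1
  · exact K.zero_mem

theorem IsCoercive.flip {b : V →L[ℝ] V →L[ℝ] ℝ} (hb : IsCoercive b) : IsCoercive b.flip := hb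

theorem IsCoercive.galerkinSolution_spec {b : V →L[ℝ] V →L[ℝ] ℝ} (hb : IsCoercive b)
    (K : Submodule ℝ V) [CompleteSpace K] (g : StrongDual ℝ V) :
    ∀ v ∈ K, b (galerkinSolution b K g) v = g v := by
  have hex : ∃ y ∈ K, ∀ v ∈ K, b y v = g v := by
    have hc : IsCoercive (b.bilinearComp K.subtypeL K.subtypeL) := by
      obtain ⟨c, hc, h⟩ := hb
      exact ⟨c, hc, fun u => h u⟩
    let r := (InnerProductSpace.toDual ℝ K).symm (g.comp K.subtypeL)
    refine ⟨hc.continuousLinearEquivOfBilin.symm r, Submodule.coe_mem _, fun v hv => ?_⟩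
    have h1 := hc.continuousLinearEquivOfBilin_apply
      (hc.continuousLinearEquivOfBilin.symm r) ⟨v, hv⟩
    rw [ContinuousLinearEquiv.apply_symm_apply, InnerProductSpace.toDual_symm_apply] at h1
    exact h1.symm
  unfold galerkinSolution
  rw [dif_pos hex]
  exact hex.choose_spec.2

theorem IsCoercive.eq_galerkinSolution {b : V →L[ℝ] V →L[ℝ] ℝ} (hb : IsCoercive b)
    (K : Submodule ℝ V) [CompleteSpace K] (g : StrongDual ℝ V) {y : V} (hy : y ∈ K)
    (h : ∀ v ∈ K, b y v = g v) : galerkinSolution b K g = y := by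
  have hm := K.sub_mem (galerkinSolution_mem b K g) hy
  have h0 : b (galerkinSolution b K g - y) (galerkinSolution b K g - y) = 0 := by
    rw [map_sub b, sub_apply, hb.galerkinSolution_spec K g _ hm, h _ hm,
      sub_self]
  obtain ⟨c, hc, hcb⟩ := hb
  have h1 := hcb (galerkinSolution b K g - y)
  rw [h0] at h1
  have h2 : ‖galerkinSolution b K g - y‖ = 0 := by
    have : 0 ≤ ‖galerkinSolution b K g - y‖ := norm_nonneg _
    by_contra hne
    have : 0 < ‖galerkinSolution b K g - y‖ := lt_of_le_of_ne this (Ne.symm hne)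
    have : 0 < c * ‖galerkinSolution b K g - y‖ * ‖galerkinSolution b K g - y‖ := by positivity
    linarith
  exact sub_eq_zero.1 (norm_eq_zero.1 h2)

theorem IsCoercive.galerkinSolution_sub {b : V →L[ℝ] V →L[ℝ] ℝ} (hb : IsCoercive b)
    (K : Submodule ℝ V) [CompleteSpace K] (g g' : StrongDual ℝ V) :
    galerkinSolution b K (g - g') = galerkinSolution b K g - galerkinSolution b K g' := by
  refine hb.eq_galerkinSolution K _
    (K.sub_mem (galerkinSolution_mem b K g) (galerkinSolution_mem b K g')) fun v hv => ?_
  rw [map_sub b, sub_apply, hb.galerkinSolution_spec K g v hv,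
    hb.galerkinSolution_spec K g' v hv, sub_apply]

/-- The solution operators of `b` and of its transpose are dual to each other. -/
theorem IsCoercive.galerkinSolution_flip_apply {b : V →L[ℝ] V →L[ℝ] ℝ} (hb : IsCoercive b)
    (K : Submodule ℝ V) [CompleteSpace K] (g g' : StrongDual ℝ V) :
    g (galerkinSolution b.flip K g') = g' (galerkinSolution b K g) := by
  rw [← hb.galerkinSolution_spec K g _ (galerkinSolution_mem _ K g'),
    ← hb.flip.galerkinSolution_spec K g' _ (galerkinSolution_mem _ K g),
    ContinuousLinearMap.flip_apply]

/-- The stability constant of the solution operator is also one of the adjoint solution operator. -/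
theorem IsCoercive.norm_galerkinSolution_flip_le [CompleteSpace V]
    {b : V →L[ℝ] V →L[ℝ] ℝ} (hb : IsCoercive b) {c : ℝ}
    (hc : ∀ g : StrongDual ℝ V, ‖galerkinSolution b ⊤ g‖ ≤ c * ‖g‖) (g : StrongDual ℝ V) :
    ‖galerkinSolution b.flip ⊤ g‖ ≤ c * ‖g‖ := by
  have : CompleteSpace (⊤ : Submodule ℝ V) :=
    completeSpace_coe_iff_isComplete.2 (by simpa using isClosed_univ.isComplete)
  set x := galerkinSolution b.flip ⊤ g with hx
  -- Test with the functional `(x, ·)`.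
  have h1 : ‖x‖ ^ 2 = g (galerkinSolution b ⊤ (innerSL ℝ x)) := by
    rw [← hb.galerkinSolution_flip_apply ⊤ (innerSL ℝ x) g, ← hx, innerSL_apply_apply,
      real_inner_self_eq_norm_sq]
  have h2 : ‖x‖ ^ 2 ≤ ‖g‖ * (c * ‖x‖) := by
    rw [h1]
    calc g (galerkinSolution b ⊤ (innerSL ℝ x)) ≤ ‖g‖ * ‖galerkinSolution b ⊤ (innerSL ℝ x)‖ :=
          (le_abs_self _).trans (g.le_opNorm _)
      _ ≤ ‖g‖ * (c * ‖x‖) := by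
          gcongr
          simpa using hc (innerSL ℝ x)
  rcases (norm_nonneg x).eq_or_lt with h | h
  · rw [← h]
    exact (norm_nonneg _).trans (hc g)
  · nlinarith

end Galerkin

/-! ### Quadratic functionals -/

section Quadratic

variable {U : Type*} [NormedAddCommGroup U] [InnerProductSpace ℝ U] [CompleteSpace U]

/-- The first-order condition for `J(u) = (1/2) (T u, u) - (g, u) + c + (ν/2) ‖u‖²`.
An everywhere defined symmetric map `T` is automatically linear and bounded
(Hellinger–Toeplitz), so that a minimizer exists by the Lax–Milgram theorem. -/
theorem argminimizer_quadratic {T : U → U} (hsymm : ∀ u v, inner ℝ (T u) v = inner ℝ u (T v))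
    (hpos : ∀ u, 0 ≤ inner ℝ (T u) u) {ν : ℝ} (hν : 0 < ν) (g : U) (c : ℝ) {J : U → ℝ}
    (hJ : ∀ u, J u = 1 / 2 * (inner ℝ (T u) u - 2 * inner ℝ g u + c) + ν / 2 * ‖u‖ ^ 2) :
    ν • argminimizer J + T (argminimizer J) = g := by
  let T' : U →ₗ[ℝ] U :=
    { toFun := T
      map_add' := fun u v => ext_inner_right ℝ fun w => by
        rw [hsymm, inner_add_left, inner_add_left, hsymm, hsymm]
      map_smul' := fun r u => ext_inner_right ℝ fun w => by
        simp only [RingHom.id_apply]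
        rw [hsymm, inner_smul_left, inner_smul_left, hsymm] }
  have hT' : T'.IsSymmetric := fun u v => hsymm u v
  have hcont : Continuous T' := hT'.continuous
  let A : U →L[ℝ] U := ν • ContinuousLinearMap.id ℝ U + ⟨T', hcont⟩
  have hA : ∀ u, A u = ν • u + T u := fun u => rfl
  have hco : IsCoercive ((innerSL ℝ).comp A : U →L[ℝ] U →L[ℝ] ℝ) := by
    refine ⟨ν, hν, fun u => ?_⟩
    rw [ContinuousLinearMap.comp_apply, innerSL_apply_apply, hA, inner_add_left,
      real_inner_smul_left, real_inner_self_eq_norm_sq]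
    nlinarith [hpos u]
  obtain ⟨w, hw⟩ : ∃ w, ν • w + T w = g := by
    refine ⟨hco.continuousLinearEquivOfBilin.symm g, ext_inner_right ℝ fun v => ?_⟩
    have h1 := hco.continuousLinearEquivOfBilin_apply (hco.continuousLinearEquivOfBilin.symm g) v
    rw [ContinuousLinearEquiv.apply_symm_apply] at h1
    rw [h1, ContinuousLinearMap.comp_apply, innerSL_apply_apply, hA]
  have hsub : ∀ u v, T (u - v) = T u - T v := fun u v => map_sub T' u v
  have key : ∀ u, J u = J w + 1 / 2 * inner ℝ (T (u - w)) (u - w) + ν / 2 * ‖u - w‖ ^ 2 := by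
    intro u
    have h1 : inner ℝ (T u) w = inner ℝ u (T w) := hsymm u w
    have h2 : inner ℝ (T w) u = inner ℝ u (T w) := real_inner_comm _ _
    have h3 : inner ℝ w u = inner ℝ u w := real_inner_comm _ _
    rw [hJ, hJ, ← hw, hsub, norm_sub_sq_real]
    simp only [inner_add_left, inner_sub_left, inner_sub_right, real_inner_smul_left, h1, h2, h3,
      real_inner_self_eq_norm_sq]
    ring
  have hmin : ∃ u, ∀ v, J u ≤ J v := ⟨w, fun v => by
    have := hpos (v - w)
    have h2 : 0 ≤ ν / 2 * ‖v - w‖ ^ 2 := by positivity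
    linarith [key v]⟩
  have hle : J (argminimizer J) ≤ J w := by
    unfold argminimizer
    rw [dif_pos hmin]
    exact hmin.choose_spec w
  have h0 : ‖argminimizer J - w‖ = 0 := by
    have h1 := key (argminimizer J)
    have h2 := hpos (argminimizer J - w)
    have h3 : ν / 2 * ‖argminimizer J - w‖ ^ 2 ≤ 0 := by linarith
    have h4 : ‖argminimizer J - w‖ ^ 2 ≤ 0 := by
      by_contra h
      push Not at h
      have : 0 < ν / 2 * ‖argminimizer J - w‖ ^ 2 := by positivity
      linarith
    exact pow_eq_zero_iff (two_ne_zero) |>.1 (le_antisymm h4 (sq_nonneg _))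
  rw [sub_eq_zero.1 (norm_eq_zero.1 h0)]
  exact hw

end Quadratic

/-! ### The adjoint variable for a fixed realization of the form -/

theorem meshSize_pos (l : ℕ) : 0 < meshSize l := by
  unfold meshSize; positivity

theorem meshSize_le_one (l : ℕ) : meshSize l ≤ 1 :=
  pow_le_one₀ (by norm_num) (by norm_num)

theorem meshSize_rpow_le_rpow {a b : ℝ} (h : a ≤ b) (l : ℕ) : meshSize l ^ b ≤ meshSize l ^ a :=
  Real.rpow_le_rpow_of_exponent_ge (meshSize_pos l) (meshSize_le_one l) h

theorem meshSize_rpow_pred {l : ℕ} (hl : 1 ≤ l) (a : ℝ) :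
    meshSize (l - 1) ^ a = 2 ^ a * meshSize l ^ a := by
  obtain ⟨k, rfl⟩ := Nat.exists_eq_add_of_le' hl
  rw [← Real.mul_rpow (by norm_num) (meshSize_pos _).le]
  congr 1
  simp only [meshSize, Nat.add_sub_cancel, pow_succ]
  ring

namespace ControlProblem

variable {Ω U V H Z W : Type*}
  [NormedAddCommGroup U] [InnerProductSpace ℝ U] [NormedAddCommGroup V] [InnerProductSpace ℝ V]
  [NormedAddCommGroup H] [InnerProductSpace ℝ H] [NormedAddCommGroup Z] [InnerProductSpace ℝ Z]
  [NormedAddCommGroup W] [InnerProductSpace ℝ W]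

theorem observation_sub (P : ControlProblem Ω U V H Z W) {ω : Ω} (hω : IsCoercive (P.a ω))
    (K : Submodule ℝ V) [CompleteSpace K] (u v : U) :
    P.observation K ω (u - v) = P.observation K ω u - P.observation K ω v := by
  have h : P.source (u - v) = P.source u - P.source v := by
    simp [source, ContinuousLinearMap.sub_comp]
  simp only [observation, S, h, hω.galerkinSolution_sub, map_sub]

theorem observation_zero (P : ControlProblem Ω U V H Z W) {ω : Ω} (hω : IsCoercive (P.a ω))
    (K : Submodule ℝ V) [CompleteSpace K] : P.observation K ω 0 = 0 := by
  simpa using P.observation_sub hω K 0 0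

/-- The adjoint operator `S_K^{ω,*} C* Λ_H` of the control-to-observation map, with values
in `Z`. -/
noncomputable def adjointObservation (P : ControlProblem Ω U V H Z W) (K : Submodule ℝ V) (ω : Ω)
    (h : H) : Z :=
  P.inclZ (P.Sadj K ω (P.obsSource h))

theorem p_eq_adjointObservation (P : ControlProblem Ω U V H Z W) (K : Submodule ℝ V) (u : U)
    (ω : Ω) : P.p K u ω = P.adjointObservation K ω (P.yd - P.observation K ω u) := rfl

theorem obsSource_sub (P : ControlProblem Ω U V H Z W) (h h' : H) :
    P.obsSource (h - h') = P.obsSource h - P.obsSource h' := by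
  simp [obsSource, ContinuousLinearMap.sub_comp]

theorem adjointObservation_sub (P : ControlProblem Ω U V H Z W) {ω : Ω} (hω : IsCoercive (P.a ω))
    (K : Submodule ℝ V) [CompleteSpace K] (h h' : H) :
    P.adjointObservation K ω (h - h') =
      P.adjointObservation K ω h - P.adjointObservation K ω h' := by
  simp only [adjointObservation, Sadj, obsSource_sub, hω.flip.galerkinSolution_sub, map_sub]

/-- Duality between the control-to-observation map and its adjoint. -/
theorem B_apply_adjointObservation (P : ControlProblem Ω U V H Z W) {ω : Ω}
    (hω : IsCoercive (P.a ω)) (K : Submodule ℝ V) [CompleteSpace K] (w : U) (h : H) :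
    P.B w (P.adjointObservation K ω h) = inner ℝ h (P.observation K ω w) :=
  hω.galerkinSolution_flip_apply K (P.source w) (P.obsSource h)

theorem p_sub_p (P : ControlProblem Ω U V H Z W) {ω : Ω} (hω : IsCoercive (P.a ω))
    (K : Submodule ℝ V) [CompleteSpace K] (u v : U) :
    P.p K v ω - P.p K u ω = P.adjointObservation K ω (P.observation K ω (u - v)) := by
  rw [p_eq_adjointObservation, p_eq_adjointObservation, ← P.adjointObservation_sub hω,
    P.observation_sub hω, sub_sub_sub_cancel_left]

theorem B_apply_p_sub_p (P : ControlProblem Ω U V H Z W) {ω : Ω}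
    (hω : IsCoercive (P.a ω)) (K : Submodule ℝ V) [CompleteSpace K] (w u v : U) :
    P.B w (P.p K v ω - P.p K u ω) =
      inner ℝ (P.observation K ω (u - v)) (P.observation K ω w) := by
  rw [P.p_sub_p hω, P.B_apply_adjointObservation hω]

theorem B_apply_p_zero (P : ControlProblem Ω U V H Z W) {ω : Ω}
    (hω : IsCoercive (P.a ω)) (K : Submodule ℝ V) [CompleteSpace K] (w : U) :
    P.B w (P.p K 0 ω) = inner ℝ P.yd (P.observation K ω w) := by
  rw [p_eq_adjointObservation, P.observation_zero hω, sub_zero, P.B_apply_adjointObservation hω]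

/-- The tracking term is an affine function of the adjoint variable. Hence it inherits
measurability and integrability from the latter. -/
theorem norm_observation_sub_sq (P : ControlProblem Ω U V H Z W) {ω : Ω}
    (hω : IsCoercive (P.a ω)) (K : Submodule ℝ V) [CompleteSpace K] (u : U) :
    ‖P.observation K ω u - P.yd‖ ^ 2 =
      P.B u (P.p K 0 ω - P.p K u ω) - 2 * P.B u (P.p K 0 ω) + ‖P.yd‖ ^ 2 := by
  rw [P.B_apply_p_sub_p hω, P.B_apply_p_zero hω, sub_zero,
    norm_sub_sq_real, real_inner_self_eq_norm_sq, real_inner_comm]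

section Riesz

variable [CompleteSpace U]

theorem inner_rieszBadj (P : ControlProblem Ω U V H Z W) (z : Z) (v : U) :
    inner ℝ (P.rieszBadj z) v = P.B v z := by
  rw [rieszBadj, InnerProductSpace.toDual_symm_apply, ContinuousLinearMap.flip_apply]

/-- `Λ_U⁻¹ B*` as a continuous linear map. -/
noncomputable def rieszBadjL (P : ControlProblem Ω U V H Z W) : Z →L[ℝ] U :=
  LinearMap.mkContinuous
    { toFun := P.rieszBadj
      map_add' := fun x y => ext_inner_right ℝ fun v => by
        simp only [inner_add_left, inner_rieszBadj, map_add]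
      map_smul' := fun r x => ext_inner_right ℝ fun v => by
        simp only [RingHom.id_apply, real_inner_smul_left, inner_rieszBadj, map_smul, smul_eq_mul] }
    ‖P.B‖ fun z => by
      simp only [LinearMap.coe_mk, AddHom.coe_mk, rieszBadj, LinearIsometryEquiv.norm_map]
      exact ((P.B.flip).le_opNorm z).trans_eq (by rw [ContinuousLinearMap.opNorm_flip])

theorem rieszBadjL_apply (P : ControlProblem Ω U V H Z W) (z : Z) :
    P.rieszBadjL z = P.rieszBadj z := rfl

theorem inner_rieszBadjL (P : ControlProblem Ω U V H Z W) (z : Z) (v : U) :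
    inner ℝ (P.rieszBadjL z) v = P.B v z := P.inner_rieszBadj z v

theorem norm_rieszBadjL_le (P : ControlProblem Ω U V H Z W) (z : Z) :
    ‖P.rieszBadjL z‖ ≤ ‖P.B‖ * ‖z‖ :=
  P.rieszBadjL.le_of_opNorm_le (LinearMap.mkContinuous_norm_le _ (norm_nonneg P.B) _) z

end Riesz

end ControlProblem

/-! ### Random variables with all moments -/

section Moments

variable {Ω : Type*} [MeasurableSpace Ω] {μ : Measure Ω}

/-- The random variable `f` has finite moments of all orders. -/
def HasAllMoments (f : Ω → ℝ) (μ : Measure Ω) : Prop :=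
  ∀ q : ℝ, 1 ≤ q → MemLp f (ENNReal.ofReal q) μ

theorem HasAllMoments.add {f g : Ω → ℝ} (hf : HasAllMoments f μ) (hg : HasAllMoments g μ) :
    HasAllMoments (fun ω => f ω + g ω) μ := fun q hq => (hf q hq).add (hg q hq)

theorem HasAllMoments.mul {f g : Ω → ℝ} (hf : HasAllMoments f μ) (hg : HasAllMoments g μ) :
    HasAllMoments (fun ω => f ω * g ω) μ := fun q hq => by
  have : ENNReal.HolderTriple (ENNReal.ofReal (2 * q)) (ENNReal.ofReal (2 * q))
      (ENNReal.ofReal q) := ⟨by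
    rw [ENNReal.ofReal_mul (by norm_num), ENNReal.mul_inv (by simp) (by simp), ← two_mul,
      ← mul_assoc]
    norm_num
    rw [ENNReal.mul_inv_cancel (by simp) (by simp), one_mul]⟩
  exact (hg (2 * q) (by linarith)).mul (hf (2 * q) (by linarith))

theorem HasAllMoments.const_mul {f : Ω → ℝ} (hf : HasAllMoments f μ) (c : ℝ) :
    HasAllMoments (fun ω => c * f ω) μ := fun q hq => (hf q hq).const_mul c

theorem HasAllMoments.abs {f : Ω → ℝ} (hf : HasAllMoments f μ) :
    HasAllMoments (fun ω => |f ω|) μ := fun q hq => (hf q hq).norm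

end Moments

namespace ControlProblem

variable {Ω U V H Z W : Type*} [MeasurableSpace Ω]
  [NormedAddCommGroup U] [InnerProductSpace ℝ U] [NormedAddCommGroup V] [InnerProductSpace ℝ V]
  [NormedAddCommGroup H] [InnerProductSpace ℝ H] [NormedAddCommGroup Z] [InnerProductSpace ℝ Z]
  [NormedAddCommGroup W] [InnerProductSpace ℝ W] [CompleteSpace V]

/-- The discretization error of the adjoint variable, with a constant that has all moments. -/
theorem exists_adjoint_error_bound {μ : Measure Ω} [IsProbabilityMeasure μ]
    {P : ControlProblem Ω U V H Z W} (hP : P.WellPosed μ) {Vh : ℕ → Submodule ℝ V}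
    [∀ l, CompleteSpace (Vh l)] {αW αZ : ℝ}
    (hα : 0 ≤ min αW αZ) (hFEM : P.FEMAssumption μ Vh αW αZ) :
    ∃ D : Ω → ℝ, HasAllMoments D μ ∧ (∀ ω, 0 ≤ D ω) ∧ ∀ᵐ ω ∂μ, IsCoercive (P.a ω) ∧
      ∀ l u,
        ‖P.p ⊤ u ω - P.p (Vh l) u ω‖ ≤ D ω * meshSize l ^ (min αW αZ) * (‖P.yd‖ + ‖u‖) ∧
        ‖P.adjointObservation ⊤ ω (P.observation ⊤ ω u) -
          P.adjointObservation (Vh l) ω (P.observation (Vh l) ω u)‖ ≤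
            D ω * meshSize l ^ (min αW αZ) * ‖u‖ := by
  obtain ⟨CS, hCS, hCS'⟩ := hP.stable
  obtain ⟨Ca, hCa, hCa'⟩ := hFEM.forward
  obtain ⟨Cs, hCs, hCs'⟩ := hFEM.adjoint
  set c₁ : ℝ := ‖P.C‖ * ‖P.inclW‖ * (‖P.B‖ * ‖P.inclZ‖) with hc₁
  set c₂ : ℝ := ‖P.inclZ‖ * (‖P.C‖ * ‖P.inclW‖) with hc₂
  have hc₁0 : 0 ≤ c₁ := by positivity
  have hc₂0 : 0 ≤ c₂ := by positivity
  have hone : HasAllMoments (fun _ : Ω => (1 : ℝ)) μ := fun q _ => memLp_const 1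
  have mCS : HasAllMoments (fun ω => |CS ω|) μ := HasAllMoments.abs hCS
  have mCa : HasAllMoments (fun ω => |Ca ω|) μ := HasAllMoments.abs hCa
  have mCs : HasAllMoments (fun ω => |Cs ω|) μ := HasAllMoments.abs hCs
  refine ⟨fun ω => |Cs ω| * (1 + c₁ * |CS ω|) + (c₂ * |CS ω| + |Cs ω|) * (‖P.C‖ * |Ca ω|),
    (mCs.mul (hone.add (mCS.const_mul c₁))).add
      (((mCS.const_mul c₂).add mCs).mul (mCa.const_mul ‖P.C‖)),
    fun ω => by positivity, ?_⟩
  filter_upwards [hP.coercive, hCS', hCa', hCs'] with ω hco hS hW hZ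
  refine ⟨hco, fun l u => ?_⟩
  have : CompleteSpace (⊤ : Submodule ℝ V) :=
    completeSpace_coe_iff_isComplete.2 (by simpa using isClosed_univ.isComplete)
  set h := meshSize l
  set α := min αW αZ
  have hα0 : 0 ≤ h ^ α := Real.rpow_nonneg (meshSize_pos l).le _
  have hα1 : h ^ α ≤ 1 := Real.rpow_le_one (meshSize_pos l).le (meshSize_le_one l) hα
  have hhW : h ^ αW ≤ h ^ α := meshSize_rpow_le_rpow (min_le_left _ _) l
  have hhZ : h ^ αZ ≤ h ^ α := meshSize_rpow_le_rpow (min_le_right _ _) l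
  have hobs : ‖P.observation ⊤ ω u‖ ≤ c₁ * |CS ω| * ‖u‖ := by
    have h1 : ‖P.source u‖ ≤ ‖P.B‖ * ‖u‖ * ‖P.inclZ‖ :=
      (ContinuousLinearMap.opNorm_comp_le _ _).trans (by gcongr; exact P.B.le_opNorm u)
    calc ‖P.observation ⊤ ω u‖ ≤ ‖P.C‖ * (‖P.inclW‖ * ‖P.S ⊤ ω (P.source u)‖) :=
          (P.C.le_opNorm _).trans (by gcongr; exact P.inclW.le_opNorm _)
      _ ≤ ‖P.C‖ * (‖P.inclW‖ * (|CS ω| * (‖P.B‖ * ‖u‖ * ‖P.inclZ‖))) := by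
          gcongr
          exact (hS _).trans (by gcongr; exact le_abs_self _)
      _ = c₁ * |CS ω| * ‖u‖ := by rw [hc₁]; ring
  have hobs' : ‖P.observation ⊤ ω u - P.observation (Vh l) ω u‖ ≤
      ‖P.C‖ * |Ca ω| * h ^ α * ‖u‖ := by
    rw [observation, observation, ← map_sub, ← map_sub]
    calc _ ≤ ‖P.C‖ * ‖P.inclW (P.S ⊤ ω (P.source u) - P.S (Vh l) ω (P.source u))‖ :=
          P.C.le_opNorm _
      _ ≤ ‖P.C‖ * (|Ca ω| * h ^ α * ‖u‖) := by
          gcongr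
          refine (hW l u).trans ?_
          gcongr
          · exact Real.rpow_nonneg (meshSize_pos l).le _
          · exact le_abs_self _
      _ = _ := by ring
  have hadj (g : H) : ‖P.adjointObservation ⊤ ω g - P.adjointObservation (Vh l) ω g‖ ≤
      |Cs ω| * h ^ α * ‖g‖ := by
    rw [adjointObservation, adjointObservation, ← map_sub]
    refine (hZ l g).trans ?_
    gcongr
    · exact Real.rpow_nonneg (meshSize_pos l).le _
    · exact le_abs_self _
  have hadjl (g : H) : ‖P.adjointObservation (Vh l) ω g‖ ≤ (c₂ * |CS ω| + |Cs ω|) * ‖g‖ := by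
    have h1 : ‖P.obsSource g‖ ≤ ‖g‖ * (‖P.C‖ * ‖P.inclW‖) := by
      refine (ContinuousLinearMap.opNorm_comp_le _ _).trans ?_
      rw [innerSL_apply_norm]
      gcongr
      exact ContinuousLinearMap.opNorm_comp_le _ _
    have h2 : ‖P.adjointObservation ⊤ ω g‖ ≤ c₂ * |CS ω| * ‖g‖ := by
      calc _ ≤ ‖P.inclZ‖ * ‖P.Sadj ⊤ ω (P.obsSource g)‖ := P.inclZ.le_opNorm _
        _ ≤ ‖P.inclZ‖ * (|CS ω| * (‖g‖ * (‖P.C‖ * ‖P.inclW‖))) := by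
            gcongr
            refine (hco.norm_galerkinSolution_flip_le hS _).trans ?_
            gcongr
            exact le_abs_self _
        _ = _ := by rw [hc₂]; ring
    have h3 := hadj g
    have h4 : |Cs ω| * h ^ α * ‖g‖ ≤ |Cs ω| * 1 * ‖g‖ := by gcongr
    have h5 := norm_sub_norm_le (P.adjointObservation (Vh l) ω g) (P.adjointObservation ⊤ ω g)
    rw [norm_sub_rev] at h5
    linarith
  have main (g g' : H) (hg : ‖g - g'‖ ≤ ‖P.C‖ * |Ca ω| * h ^ α * ‖u‖) :
      ‖P.adjointObservation ⊤ ω g - P.adjointObservation (Vh l) ω g'‖ ≤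
        |Cs ω| * h ^ α * ‖g‖ + (c₂ * |CS ω| + |Cs ω|) * (‖P.C‖ * |Ca ω| * h ^ α * ‖u‖) := by
    have h1 : P.adjointObservation ⊤ ω g - P.adjointObservation (Vh l) ω g' =
        (P.adjointObservation ⊤ ω g - P.adjointObservation (Vh l) ω g) +
          P.adjointObservation (Vh l) ω (g - g') := by
      rw [P.adjointObservation_sub hco]; abel
    rw [h1]
    refine (norm_add_le _ _).trans (add_le_add (hadj g) ((hadjl _).trans ?_))
    gcongr
  constructor
  · rw [p_eq_adjointObservation, p_eq_adjointObservation]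
    refine (main _ _ ?_).trans ?_
    · rw [sub_sub_sub_cancel_left, norm_sub_rev]
      exact hobs'
    · have h1 : ‖P.yd - P.observation ⊤ ω u‖ ≤ (1 + c₁ * |CS ω|) * (‖P.yd‖ + ‖u‖) := by
        have := norm_sub_le P.yd (P.observation ⊤ ω u)
        nlinarith [mul_nonneg (mul_nonneg hc₁0 (abs_nonneg (CS ω))) (norm_nonneg P.yd),
          norm_nonneg u]
      have h2 : ‖u‖ ≤ ‖P.yd‖ + ‖u‖ := by linarith [norm_nonneg P.yd]
      calc _ ≤ |Cs ω| * h ^ α * ((1 + c₁ * |CS ω|) * (‖P.yd‖ + ‖u‖)) +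
            (c₂ * |CS ω| + |Cs ω|) * (‖P.C‖ * |Ca ω| * h ^ α * (‖P.yd‖ + ‖u‖)) := by gcongr
        _ = _ := by ring
  · refine (main _ _ hobs').trans ?_
    have h1 : ‖P.observation ⊤ ω u‖ ≤ (1 + c₁ * |CS ω|) * ‖u‖ := by
      linarith [norm_nonneg u]
    calc _ ≤ |Cs ω| * h ^ α * ((1 + c₁ * |CS ω|) * ‖u‖) +
          (c₂ * |CS ω| + |Cs ω|) * (‖P.C‖ * |Ca ω| * h ^ α * ‖u‖) := by gcongr
      _ = _ := by ring

end ControlProblem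

/-! ### Randomized quadrature formulae -/

namespace RandomizedQuadrature

variable {Ω Θ : Type*} [MeasurableSpace Ω] [MeasurableSpace Θ]
  (Q : RandomizedQuadrature Ω Θ) (θ : Θ)

section Algebra

variable {E F : Type*} [NormedAddCommGroup E] [NormedSpace ℝ E] [NormedAddCommGroup F]
  [NormedSpace ℝ F]

theorem apply_add (f g : Ω → E) :
    Q.apply θ (fun ω => f ω + g ω) = Q.apply θ f + Q.apply θ g := by
  simp [apply, smul_add, Finset.sum_add_distrib]

theorem apply_sub (f g : Ω → E) :
    Q.apply θ (fun ω => f ω - g ω) = Q.apply θ f - Q.apply θ g := by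
  simp [apply, smul_sub, Finset.sum_sub_distrib]

theorem apply_const (c : ℝ) : Q.apply θ (fun _ => c) = c := by
  simp [apply, ← Finset.sum_mul, Q.sum_weight]

theorem apply_mul_const (f : Ω → ℝ) (c : ℝ) :
    Q.apply θ (fun ω => f ω * c) = Q.apply θ f * c := by
  simp [apply, Finset.sum_mul, mul_assoc]

theorem map_apply (L : E →L[ℝ] F) (f : Ω → E) :
    L (Q.apply θ f) = Q.apply θ (fun ω => L (f ω)) := by
  simp [apply]

theorem apply_congr {f g : Ω → E} (h : ∀ j, f (Q.node j θ) = g (Q.node j θ)) :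
    Q.apply θ f = Q.apply θ g := by
  simp [apply, h]

theorem apply_mono {f g : Ω → ℝ} (h : ∀ j, f (Q.node j θ) ≤ g (Q.node j θ)) :
    Q.apply θ f ≤ Q.apply θ g :=
  Finset.sum_le_sum fun j _ => mul_le_mul_of_nonneg_left (h j) (Q.weight_pos j θ).le

theorem apply_nonneg {f : Ω → ℝ} (h : ∀ j, 0 ≤ f (Q.node j θ)) : 0 ≤ Q.apply θ f :=
  Finset.sum_nonneg fun j _ => mul_nonneg (Q.weight_pos j θ).le (h j)

theorem norm_apply_le (f : Ω → E) : ‖Q.apply θ f‖ ≤ Q.apply θ (fun ω => ‖f ω‖) := by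
  refine (norm_sum_le _ _).trans_eq (Finset.sum_congr rfl fun j _ => ?_)
  rw [norm_smul, Real.norm_of_nonneg (Q.weight_pos j θ).le, smul_eq_mul]

end Algebra

variable {Q} {μ : Measure Ω} {ρ : Measure Θ}

/-- Almost surely, no node of an unbiased quadrature formula lies in a given null set:
the expected total weight of such nodes vanishes. -/
theorem IsUnbiased.ae_node (hQ : Q.IsUnbiased μ ρ) {s : Ω → Prop} (hs : ∀ᵐ ω ∂μ, s ω) :
    ∀ᵐ θ ∂ρ, ∀ j, s (Q.node j θ) := by
  obtain ⟨t, hst, htm, ht⟩ := exists_measurable_superset_of_null (ae_iff.1 hs)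
  have hint : Integrable (t.indicator fun _ => (1 : ℝ)) μ :=
    (integrable_indicator_iff htm).2 (integrableOn_const (by simp [ht]) (by simp))
  obtain ⟨h1, h2⟩ := hQ _ hint
  have h0 : ∀ θ j, 0 ≤ t.indicator (fun _ => (1 : ℝ)) (Q.node j θ) := fun θ j =>
    Set.indicator_nonneg (fun _ _ => zero_le_one) _
  rw [integral_indicator_const _ htm, Measure.real, ht, ENNReal.toReal_zero, zero_smul,
    integral_eq_zero_iff_of_nonneg (fun θ => Q.apply_nonneg θ (h0 θ)) h1] at h2
  filter_upwards [h2] with θ hθ j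
  by_contra hj
  have h3 := (Finset.sum_eq_zero_iff_of_nonneg (fun i _ =>
    mul_nonneg (Q.weight_pos i θ).le (h0 θ i))).1 hθ j (Finset.mem_univ j)
  have h4 : Q.node j θ ∈ t := hst hj
  rw [Set.indicator_of_mem h4, mul_one] at h3
  exact (Q.weight_pos j θ).ne' h3

theorem IsUnbiased.quasiMeasurePreserving_node (hQ : Q.IsUnbiased μ ρ) (j : Fin Q.n) :
    Measure.QuasiMeasurePreserving (Q.node j) ρ μ := by
  refine ⟨Q.measurable_node j, Measure.AbsolutelyContinuous.mk fun s hs hμ => ?_⟩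
  rw [Measure.map_apply (Q.measurable_node j) hs]
  have h1 : ∀ᵐ ω ∂μ, ω ∉ s := measure_eq_zero_iff_ae_notMem.1 hμ
  exact measure_eq_zero_iff_ae_notMem.2 ((hQ.ae_node h1).mono fun θ h => h j)

theorem IsUnbiased.aestronglyMeasurable_apply {E : Type*} [NormedAddCommGroup E] [NormedSpace ℝ E]
    (hQ : Q.IsUnbiased μ ρ) {f : Ω → E} (hf : AEStronglyMeasurable f μ) :
    AEStronglyMeasurable (fun θ => Q.apply θ f) ρ := by
  unfold apply
  refine Finset.aestronglyMeasurable_fun_sum _ fun j _ => ?_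
  exact (Q.measurable_weight j).aestronglyMeasurable.smul
    (hf.comp_quasiMeasurePreserving (hQ.quasiMeasurePreserving_node j))

/-- Unbiased quadrature formulae are contractions from `L^s(Ω)` to `L^s(Θ)`, by Jensen's
inequality. -/
theorem IsUnbiased.eLpNorm_apply_le (hQ : Q.IsUnbiased μ ρ) {X : Ω → ℝ} (hX : ∀ ω, 0 ≤ X ω)
    {s : ℝ} (hs : 1 ≤ s) (hXs : MemLp X (ENNReal.ofReal s) μ) :
    eLpNorm (fun θ => Q.apply θ X) (ENNReal.ofReal s) ρ ≤ eLpNorm X (ENNReal.ofReal s) μ := by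
  have hs0 : 0 < s := by linarith
  have hs' : ENNReal.ofReal s ≠ 0 := by simpa using hs0
  have hint : Integrable (fun ω => X ω ^ s) μ := by
    have := hXs.integrable_norm_rpow hs' ENNReal.ofReal_ne_top
    simpa [ENNReal.toReal_ofReal hs0.le, abs_of_nonneg (hX _)] using this
  obtain ⟨h1, h2⟩ := hQ _ hint
  rw [eLpNorm_eq_lintegral_rpow_enorm_toReal hs' ENNReal.ofReal_ne_top,
    eLpNorm_eq_lintegral_rpow_enorm_toReal hs' ENNReal.ofReal_ne_top,
    ENNReal.toReal_ofReal hs0.le]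
  refine ENNReal.rpow_le_rpow ?_ (by positivity)
  have henorm : ∀ x : ℝ, 0 ≤ x → ‖x‖ₑ ^ s = ENNReal.ofReal (x ^ s) := fun x hx => by
    rw [Real.enorm_eq_ofReal hx, ENNReal.ofReal_rpow_of_nonneg hx hs0.le]
  calc ∫⁻ θ, ‖Q.apply θ X‖ₑ ^ s ∂ρ ≤ ∫⁻ θ, ENNReal.ofReal (Q.apply θ fun ω => X ω ^ s) ∂ρ := by
        refine lintegral_mono fun θ => ?_
        rw [henorm _ (Q.apply_nonneg θ fun j => hX _)]
        refine ENNReal.ofReal_le_ofReal ?_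
        exact Real.rpow_arith_mean_le_arith_mean_rpow _ _ _ (fun j _ => (Q.weight_pos j θ).le)
          (Q.sum_weight θ) (fun j _ => hX _) hs
    _ = ∫⁻ ω, ‖X ω‖ₑ ^ s ∂μ := by
        rw [← ofReal_integral_eq_lintegral_ofReal h1 (Filter.Eventually.of_forall fun θ =>
          Q.apply_nonneg θ fun j => Real.rpow_nonneg (hX _) _), h2,
          ofReal_integral_eq_lintegral_ofReal hint (Filter.Eventually.of_forall fun ω =>
            Real.rpow_nonneg (hX _) _)]
        exact lintegral_congr fun ω => (henorm _ (hX ω)).symm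

end RandomizedQuadrature

/-! ### First-order optimality conditions -/

namespace ControlProblem

variable {Ω U V H Z W : Type*} [MeasurableSpace Ω]
  [NormedAddCommGroup U] [InnerProductSpace ℝ U] [NormedAddCommGroup V] [InnerProductSpace ℝ V]
  [NormedAddCommGroup H] [InnerProductSpace ℝ H] [NormedAddCommGroup Z] [InnerProductSpace ℝ Z]
  [NormedAddCommGroup W] [InnerProductSpace ℝ W] [CompleteSpace U]

/-- The optimality condition `ν u = Λ_U⁻¹ B* E[p(u)]`. -/
theorem optControl_optimality [CompleteSpace Z] {μ : Measure Ω} [IsProbabilityMeasure μ]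
    (P : ControlProblem Ω U V H Z W)
    (hco : ∀ᵐ ω ∂μ, IsCoercive (P.a ω)) (K : Submodule ℝ V) [CompleteSpace K]
    (hint : ∀ u, Integrable (P.p K u) μ) :
    P.ν • P.optControl μ K = P.rieszBadjL (∫ ω, P.p K (P.optControl μ K) ω ∂μ) := by
  have hdiff : ∀ u, Integrable (fun ω => P.p K 0 ω - P.p K u ω) μ :=
    fun u => (hint 0).sub (hint u)
  let T : U → U := fun u => P.rieszBadjL (∫ ω, (P.p K 0 ω - P.p K u ω) ∂μ)
  have hT : ∀ u v, inner ℝ (T u) v =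
      ∫ ω, inner ℝ (P.observation K ω u) (P.observation K ω v) ∂μ := by
    intro u v
    rw [inner_rieszBadjL, ← ContinuousLinearMap.integral_comp_comm _ (hdiff u)]
    refine integral_congr_ae (hco.mono fun ω hω => ?_)
    simp only [P.B_apply_p_sub_p hω, sub_zero]
  have h := argminimizer_quadratic (T := T)
    (fun u v => by
      rw [real_inner_comm (T v) u, hT, hT]
      exact integral_congr_ae (Filter.Eventually.of_forall fun ω => real_inner_comm _ _))
    (fun u => by rw [hT]; exact integral_nonneg fun ω => real_inner_self_nonneg) P.ν_pos
    (P.rieszBadjL (∫ ω, P.p K 0 ω ∂μ)) (‖P.yd‖ ^ 2)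
    (J := fun u => 1 / 2 * ∫ ω, ‖P.observation K ω u - P.yd‖ ^ 2 ∂μ + P.ν / 2 * ‖u‖ ^ 2)
    (fun u => by
      have e1 : ∫ ω, ‖P.observation K ω u - P.yd‖ ^ 2 ∂μ = ∫ ω,
          (P.B u (P.p K 0 ω - P.p K u ω) - 2 * P.B u (P.p K 0 ω) + ‖P.yd‖ ^ 2) ∂μ :=
        integral_congr_ae (hco.mono fun ω hω => P.norm_observation_sub_sq hω K u)
      have i1 : Integrable (fun ω => P.B u (P.p K 0 ω - P.p K u ω)) μ :=
        (P.B u).integrable_comp (hdiff u)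
      have i2 : Integrable (fun ω => 2 * P.B u (P.p K 0 ω)) μ :=
        ((P.B u).integrable_comp (hint 0)).const_mul 2
      rw [e1, integral_add (show Integrable (fun ω => P.B u (P.p K 0 ω - P.p K u ω) -
          2 * P.B u (P.p K 0 ω)) μ from i1.sub i2) (integrable_const _), integral_sub i1 i2,
        integral_const_mul, ContinuousLinearMap.integral_comp_comm _ (hdiff u),
        ContinuousLinearMap.integral_comp_comm _ (hint 0), inner_rieszBadjL, inner_rieszBadjL]
      simp)
  change P.ν • P.optControl μ K + T (P.optControl μ K) = _ at h
  rw [← sub_eq_iff_eq_add.2 h.symm, ← map_sub, integral_sub (hint 0) (hint _), sub_sub_cancel]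

theorem inner_rieszBadjL_apply {Θ : Type*} [MeasurableSpace Θ] (P : ControlProblem Ω U V H Z W)
    (Q : RandomizedQuadrature Ω Θ) (θ : Θ) (f : Ω → Z) (v : U) :
    inner ℝ (P.rieszBadjL (Q.apply θ f)) v = Q.apply θ fun ω => P.B v (f ω) := by
  rw [inner_rieszBadjL, Q.map_apply]

/-- The optimality condition `ν u = Λ_U⁻¹ B* 𝒬[p(u)]`, for a sample whose nodes are all
realizations with a coercive form. -/
theorem quadControl_optimality {Θ : Type*} [MeasurableSpace Θ] (P : ControlProblem Ω U V H Z W)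
    (K : Submodule ℝ V) [CompleteSpace K] {Q : RandomizedQuadrature Ω Θ} {θ : Θ}
    (hco : ∀ j, IsCoercive (P.a (Q.node j θ))) :
    P.ν • P.quadControl K Q θ = P.rieszBadjL (P.quadAdjoint K Q θ) := by
  let T : U → U := fun u => P.rieszBadjL (Q.apply θ fun ω => P.p K 0 ω - P.p K u ω)
  have hT : ∀ u v, inner ℝ (T u) v =
      Q.apply θ fun ω => inner ℝ (P.observation K ω u) (P.observation K ω v) := by
    intro u v
    rw [inner_rieszBadjL_apply]
    exact Q.apply_congr θ fun j => by simp only [P.B_apply_p_sub_p (hco j), sub_zero]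
  have h := argminimizer_quadratic (T := T)
    (fun u v => by
      rw [real_inner_comm (T v) u, hT, hT]
      exact Q.apply_congr θ fun j => real_inner_comm _ _)
    (fun u => by rw [hT]; exact Q.apply_nonneg θ fun j => real_inner_self_nonneg) P.ν_pos
    (P.rieszBadjL (Q.apply θ (P.p K 0))) (‖P.yd‖ ^ 2)
    (J := fun u => 1 / 2 * Q.apply θ (fun ω => ‖P.observation K ω u - P.yd‖ ^ 2) +
      P.ν / 2 * ‖u‖ ^ 2)
    (fun u => by
      rw [Q.apply_congr θ (g := fun ω => P.B u (P.p K 0 ω - P.p K u ω) - 2 * P.B u (P.p K 0 ω) +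
        ‖P.yd‖ ^ 2) fun j => P.norm_observation_sub_sq (hco j) K u, Q.apply_add,
        Q.apply_sub, Q.apply_const, inner_rieszBadjL_apply, inner_rieszBadjL_apply]
      simp only [two_mul, Q.apply_add])
  change P.ν • P.quadControl K Q θ + T (P.quadControl K Q θ) = _ at h
  rw [← sub_eq_iff_eq_add.2 h.symm, ← map_sub, Q.apply_sub, sub_sub_cancel]
  rfl

end ControlProblem

/-! ### Measurability of the discrete optimal controls -/

theorem aemeasurable_det {Θ ι : Type*} [MeasurableSpace Θ] {ρ : Measure Θ} [Fintype ι]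
    [DecidableEq ι] {M : Θ → Matrix ι ι ℝ} (hM : ∀ i j, AEMeasurable (fun θ => M θ i j) ρ) :
    AEMeasurable (fun θ => (M θ).det) ρ := by
  simp only [Matrix.det_apply]
  exact Finset.aemeasurable_fun_sum _ fun σ _ =>
    (Finset.aemeasurable_fun_prod _ fun i _ => hM _ _).const_smul (Equiv.Perm.sign σ)

theorem aemeasurable_inv_mulVec {Θ ι : Type*} [MeasurableSpace Θ] {ρ : Measure Θ} [Fintype ι]
    [DecidableEq ι] {M : Θ → Matrix ι ι ℝ} (hM : ∀ i j, AEMeasurable (fun θ => M θ i j) ρ)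
    {g : Θ → ι → ℝ} (hg : ∀ i, AEMeasurable (fun θ => g θ i) ρ) (i : ι) :
    AEMeasurable (fun θ => ((M θ)⁻¹.mulVec (g θ)) i) ρ := by
  simp only [Matrix.mulVec, dotProduct, Matrix.inv_def, Matrix.smul_apply, smul_eq_mul,
    Ring.inverse_eq_inv', Matrix.adjugate_apply]
  refine Finset.aemeasurable_fun_sum _ fun j _ =>
    ((aemeasurable_det hM).inv.mul (aemeasurable_det fun k l => ?_)).mul (hg j)
  simp only [Matrix.updateRow_apply]
  split_ifs
  · exact aemeasurable_const
  · exact hM k l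

namespace ControlProblem

variable {Ω Θ U V H Z W : Type*} [MeasurableSpace Ω] [MeasurableSpace Θ]
  [NormedAddCommGroup U] [InnerProductSpace ℝ U] [NormedAddCommGroup V] [InnerProductSpace ℝ V]
  [NormedAddCommGroup H] [InnerProductSpace ℝ H] [NormedAddCommGroup Z] [InnerProductSpace ℝ Z]
  [NormedAddCommGroup W] [InnerProductSpace ℝ W] [CompleteSpace U]

/-- The discrete optimal control lies in the fixed finite-dimensional space `Λ_U⁻¹ B* K`. Its
coordinates there solve a linear system with a measurable positive definite matrix, so that they
are measurable by Cramer's rule. No separability of `U` is involved. -/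
theorem aestronglyMeasurable_quadControl (P : ControlProblem Ω U V H Z W) {μ : Measure Ω}
    {ρ : Measure Θ} (hco : ∀ᵐ ω ∂μ, IsCoercive (P.a ω)) (K : Submodule ℝ V)
    [FiniteDimensional ℝ K] (hp : ∀ u, AEStronglyMeasurable (P.p K u) μ)
    {Q : RandomizedQuadrature Ω Θ} (hQ : Q.IsUnbiased μ ρ) :
    AEStronglyMeasurable (fun θ => P.quadControl K Q θ) ρ := by
  have : CompleteSpace K := FiniteDimensional.complete ℝ K
  let R : V →ₗ[ℝ] U := (P.rieszBadjL.comp P.inclZ).toLinearMap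
  let F : Submodule ℝ U := K.map R
  let b := stdOrthonormalBasis ℝ F
  let M : Θ → Matrix (Fin (Module.finrank ℝ F)) (Fin (Module.finrank ℝ F)) ℝ := fun θ =>
    P.ν • 1 + Matrix.of fun i j => Q.apply θ fun ω => P.B (b i) (P.p K 0 ω - P.p K (b j) ω)
  let g : Θ → Fin (Module.finrank ℝ F) → ℝ := fun θ i => Q.apply θ fun ω => P.B (b i) (P.p K 0 ω)
  have hM : ∀ i j, AEMeasurable (fun θ => M θ i j) ρ := fun i j => by
    simp only [M, Matrix.add_apply, Matrix.of_apply]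
    exact aemeasurable_const.add (hQ.aestronglyMeasurable_apply
      ((P.B (b i)).continuous.comp_aestronglyMeasurable ((hp 0).sub (hp (b j))))).aemeasurable
  have hg : ∀ i, AEMeasurable (fun θ => g θ i) ρ := fun i =>
    (hQ.aestronglyMeasurable_apply
      ((P.B (b i)).continuous.comp_aestronglyMeasurable (hp 0))).aemeasurable
  have hmeas : AEStronglyMeasurable
      (fun θ => ∑ i, ((M θ)⁻¹.mulVec (g θ)) i • (b i : U)) ρ :=
    Finset.aestronglyMeasurable_fun_sum _ fun i _ =>
      (aemeasurable_inv_mulVec hM hg i).aestronglyMeasurable.smul aestronglyMeasurable_const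
  refine hmeas.congr ?_
  filter_upwards [hQ.ae_node hco] with θ hθ
  have hopt := P.quadControl_optimality K hθ
  set x := P.quadControl K Q θ
  have hxF : x ∈ F := by
    have h1 : x = P.ν⁻¹ • P.rieszBadjL (P.quadAdjoint K Q θ) := by
      rw [← hopt, smul_smul, inv_mul_cancel₀ P.ν_pos.ne', one_smul]
    rw [h1]
    refine F.smul_mem _ ?_
    have h2 : P.quadAdjoint K Q θ = P.inclZ (Q.apply θ fun ω =>
        P.Sadj K ω (P.obsSource (P.yd - P.observation K ω x))) := by
      rw [Q.map_apply]; rfl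
    rw [h2]
    exact Submodule.mem_map_of_mem (K.sum_mem fun j _ => K.smul_mem _ (galerkinSolution_mem _ K _))
  have hMe : ∀ i j, M θ i j = (P.ν • (1 : Matrix _ _ ℝ)) i j + Q.apply θ fun ω =>
      inner ℝ (P.observation K ω (b i)) (P.observation K ω (b j)) := fun i j => by
    simp only [M, Matrix.add_apply, Matrix.of_apply]
    congr 1
    exact Q.apply_congr θ fun k => by
      rw [P.B_apply_p_sub_p (hθ k), sub_zero, real_inner_comm]
  -- The matrix is a positive multiple of the identity plus a mean of Gram matrices.
  have hpos : (M θ).PosDef := by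
    have h1 : M θ = P.ν • 1 + ∑ k, Q.weight k θ •
        Matrix.gram ℝ fun i => P.observation K (Q.node k θ) (b i) := by
      ext i j
      rw [hMe, Matrix.add_apply, Matrix.sum_apply]
      simp [RandomizedQuadrature.apply, Matrix.gram_apply]
    rw [h1]
    exact (Matrix.PosDef.one.smul P.ν_pos).add_posSemidef
      (Matrix.posSemidef_sum _ fun k _ => (Matrix.posSemidef_gram ℝ _).smul (Q.weight_pos k θ).le)
  let y : Fin (Module.finrank ℝ F) → ℝ := fun i => inner ℝ (b i : U) x
  have hxy : x = ∑ i, y i • (b i : U) := by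
    have h1 := b.sum_repr' ⟨x, hxF⟩
    have h2 := congrArg (fun z : F => (z : U)) h1
    simpa using h2.symm
  have hsys : (M θ).mulVec y = g θ := by
    ext i
    -- Test the optimality condition with `b i`, and expand `x` by symmetry of the Hessian.
    have h1 : P.ν * y i = Q.apply θ fun ω => P.B (b i) (P.p K x ω) := by
      have := congrArg (fun z => inner ℝ z (b i : U)) hopt
      simp only [real_inner_smul_left] at this
      rw [real_inner_comm] at this
      exact this.trans (P.inner_rieszBadjL_apply Q θ _ _)
    have h2 : (Q.apply θ fun ω => P.B (b i) (P.p K 0 ω - P.p K x ω)) =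
        ∑ j, y j * Q.apply θ fun ω =>
          inner ℝ (P.observation K ω (b i)) (P.observation K ω (b j)) := by
      calc (Q.apply θ fun ω => P.B (b i) (P.p K 0 ω - P.p K x ω))
          = Q.apply θ fun ω => P.B x (P.p K 0 ω - P.p K (b i) ω) :=
            Q.apply_congr θ fun k => by
              rw [P.B_apply_p_sub_p (hθ k), P.B_apply_p_sub_p (hθ k), sub_zero, sub_zero,
                real_inner_comm]
        _ = inner ℝ (P.rieszBadjL (Q.apply θ fun ω => P.p K 0 ω - P.p K (b i) ω)) x :=
            (P.inner_rieszBadjL_apply Q θ _ _).symm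
        _ = ∑ j, y j * inner ℝ (P.rieszBadjL (Q.apply θ fun ω => P.p K 0 ω - P.p K (b i) ω))
              (b j : U) := by
            conv_lhs => rw [hxy]
            simp only [inner_sum, real_inner_smul_right]
        _ = _ := Finset.sum_congr rfl fun j _ => by
            rw [P.inner_rieszBadjL_apply]
            congr 1
            exact Q.apply_congr θ fun k => by rw [P.B_apply_p_sub_p (hθ k), sub_zero]
    have h3 : g θ i = P.ν * y i + Q.apply θ fun ω => P.B (b i) (P.p K 0 ω - P.p K x ω) := by
      rw [h1, ← Q.apply_add]
      exact Q.apply_congr θ fun k => by rw [map_sub]; ring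
    rw [h3, h2]
    simp only [Matrix.mulVec, dotProduct, hMe, add_mul, Finset.sum_add_distrib]
    refine congrArg₂ (· + ·) ?_ (Finset.sum_congr rfl fun j _ => mul_comm _ _)
    rw [Finset.sum_eq_single i]
    · simp only [Matrix.smul_apply, Matrix.one_apply_eq, smul_eq_mul, mul_one]
    · intro j _ hj
      rw [Matrix.smul_apply, Matrix.one_apply_ne' hj, smul_zero, zero_mul]
    · exact fun h => absurd (Finset.mem_univ i) h
  rw [← hsys, Matrix.mulVec_mulVec, Matrix.nonsing_inv_mul _ hpos.det_pos.ne'.isUnit,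
    Matrix.one_mulVec, ← hxy]

end ControlProblem

/-! ### Error estimates for a fixed sample -/

/-- A coercivity argument: a perturbation `s` with `(s, x) ≥ 0` does not enlarge the solution. -/
theorem mul_norm_le_of_smul_eq_sub {U : Type*} [NormedAddCommGroup U] [InnerProductSpace ℝ U]
    {c : ℝ} {x r s : U} (h : c • x = r - s) (hs : 0 ≤ inner ℝ s x) : c * ‖x‖ ≤ ‖r‖ := by
  have h1 : c * ‖x‖ ^ 2 = inner ℝ r x - inner ℝ s x := by
    rw [← inner_sub_left, ← h, real_inner_smul_left, real_inner_self_eq_norm_sq]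
  have h2 := real_inner_le_norm r x
  rcases (norm_nonneg x).eq_or_lt with h0 | h0
  · rw [← h0, mul_zero]; exact norm_nonneg _
  · nlinarith

namespace ControlProblem

section Deterministic

variable {Ω Θ U V H Z W : Type*} [MeasurableSpace Ω] [MeasurableSpace Θ]
  [NormedAddCommGroup U] [InnerProductSpace ℝ U] [NormedAddCommGroup V] [InnerProductSpace ℝ V]
  [NormedAddCommGroup H] [InnerProductSpace ℝ H] [NormedAddCommGroup Z] [InnerProductSpace ℝ Z]
  [NormedAddCommGroup W] [InnerProductSpace ℝ W] [CompleteSpace U]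

/-- The quadrature approximation of the Hessian is positive semidefinite, since the weights are
positive. -/
theorem inner_quad_hessian_nonneg (P : ControlProblem Ω U V H Z W)
    (K : Submodule ℝ V) [CompleteSpace K] {Q : RandomizedQuadrature Ω Θ} {θ : Θ}
    (hco : ∀ j, IsCoercive (P.a (Q.node j θ))) (x : U) :
    0 ≤ inner ℝ (P.rieszBadjL
      (Q.apply θ fun ω => P.adjointObservation K ω (P.observation K ω x))) x := by
  rw [inner_rieszBadjL_apply]
  refine Q.apply_nonneg θ fun j => ?_
  rw [P.B_apply_adjointObservation (hco j)]
  exact real_inner_self_nonneg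

/-- The quadrature error of the control is controlled by the quadrature error of the adjoint
variable at the control that is exact in the stochastic variable. -/
theorem norm_optControl_sub_quadControl_le {μ : Measure Ω} (P : ControlProblem Ω U V H Z W)
    (K : Submodule ℝ V) [CompleteSpace K] {Q : RandomizedQuadrature Ω Θ} {θ : Θ}
    (hco : ∀ j, IsCoercive (P.a (Q.node j θ)))
    (hopt : P.ν • P.optControl μ K = P.rieszBadjL (∫ ω, P.p K (P.optControl μ K) ω ∂μ)) :
    P.ν * ‖P.optControl μ K - P.quadControl K Q θ‖ ≤
      ‖P.B‖ * ‖∫ ω, P.p K (P.optControl μ K) ω ∂μ -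
        Q.apply θ (P.p K (P.optControl μ K))‖ := by
  set u := P.optControl μ K
  set x := P.quadControl K Q θ with hx
  have h1 : (Q.apply θ fun ω => P.adjointObservation K ω (P.observation K ω (u - x))) =
      Q.apply θ (P.p K x) - Q.apply θ (P.p K u) := by
    rw [← Q.apply_sub]
    exact Q.apply_congr θ fun j => (P.p_sub_p (hco j) K u x).symm
  have h2 : P.ν • (u - x) = P.rieszBadjL (∫ ω, P.p K u ω ∂μ - Q.apply θ (P.p K u)) -
      P.rieszBadjL (Q.apply θ fun ω => P.adjointObservation K ω (P.observation K ω (u - x))) := by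
    rw [smul_sub, hopt, hx, P.quadControl_optimality K hco, ← hx, h1, ← map_sub, ← map_sub,
      quadAdjoint, ← hx, sub_sub_sub_cancel_right]
  exact (mul_norm_le_of_smul_eq_sub h2 (P.inner_quad_hessian_nonneg K hco _)).trans
    (P.norm_rieszBadjL_le _)

/-- The quadrature errors of the controls on two spatial levels differ by the product of the
discretization error and the quadrature error. -/
theorem norm_optControl_sub_quadControl_sub_le {μ : Measure Ω} (P : ControlProblem Ω U V H Z W)
    (K K' : Submodule ℝ V) [CompleteSpace K] [CompleteSpace K'] {Q : RandomizedQuadrature Ω Θ}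
    {θ : Θ} (hco : ∀ j, IsCoercive (P.a (Q.node j θ)))
    (hopt : P.ν • P.optControl μ K = P.rieszBadjL (∫ ω, P.p K (P.optControl μ K) ω ∂μ))
    (hopt' : P.ν • P.optControl μ K' = P.rieszBadjL (∫ ω, P.p K' (P.optControl μ K') ω ∂μ))
    (hint : Integrable (P.p K (P.optControl μ K)) μ)
    (hint' : Integrable (P.p K' (P.optControl μ K')) μ) {D : Ω → ℝ}
    (hD : ∀ j x, ‖P.adjointObservation K (Q.node j θ) (P.observation K (Q.node j θ) x) -
      P.adjointObservation K' (Q.node j θ) (P.observation K' (Q.node j θ) x)‖ ≤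
        D (Q.node j θ) * ‖x‖) :
    P.ν * ‖(P.optControl μ K - P.quadControl K Q θ) -
        (P.optControl μ K' - P.quadControl K' Q θ)‖ ≤
      ‖P.B‖ * (‖∫ ω, (P.p K (P.optControl μ K) - P.p K' (P.optControl μ K')) ω ∂μ -
          Q.apply θ (P.p K (P.optControl μ K) - P.p K' (P.optControl μ K'))‖ +
        Q.apply θ D * ‖P.optControl μ K' - P.quadControl K' Q θ‖) := by
  set e := P.optControl μ K - P.quadControl K Q θ with he
  set e' := P.optControl μ K' - P.quadControl K' Q θ with he'
  set A : U → Z := fun x =>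
    Q.apply θ fun ω => P.adjointObservation K ω (P.observation K ω x) with hA
  set A' : U → Z := fun x =>
    Q.apply θ fun ω => P.adjointObservation K' ω (P.observation K' ω x) with hA'
  have h1 : Q.apply θ (P.p K (P.quadControl K Q θ)) =
      Q.apply θ (P.p K (P.optControl μ K)) + A e := by
    rw [hA, ← sub_eq_iff_eq_add', ← Q.apply_sub]
    exact Q.apply_congr θ fun j => P.p_sub_p (hco j) K _ _
  have h1' : Q.apply θ (P.p K' (P.quadControl K' Q θ)) =
      Q.apply θ (P.p K' (P.optControl μ K')) + A' e' := by
    rw [hA', ← sub_eq_iff_eq_add', ← Q.apply_sub]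
    exact Q.apply_congr θ fun j => P.p_sub_p (hco j) K' _ _
  have h2 : A e = A (e - e') + A e' := by
    simp only [hA]
    rw [← Q.apply_add]
    refine Q.apply_congr θ fun j => ?_
    rw [← sub_eq_iff_eq_add', ← P.adjointObservation_sub (hco j), ← P.observation_sub (hco j),
      sub_sub_cancel]
  have h3 : ‖A e' - A' e'‖ ≤ Q.apply θ D * ‖e'‖ := by
    simp only [hA, hA']
    rw [← Q.apply_sub, ← Q.apply_mul_const]
    exact (Q.norm_apply_le θ _).trans (Q.apply_mono θ fun j => hD j e')
  have h4 : ∫ ω, (P.p K (P.optControl μ K) - P.p K' (P.optControl μ K')) ω ∂μ =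
      ∫ ω, P.p K (P.optControl μ K) ω ∂μ - ∫ ω, P.p K' (P.optControl μ K') ω ∂μ :=
    integral_sub hint hint'
  have h5 : Q.apply θ (P.p K (P.optControl μ K) - P.p K' (P.optControl μ K')) =
      Q.apply θ (P.p K (P.optControl μ K)) - Q.apply θ (P.p K' (P.optControl μ K')) :=
    Q.apply_sub θ _ _
  have h6 : P.ν • (e - e') = P.rieszBadjL
      ((∫ ω, (P.p K (P.optControl μ K) - P.p K' (P.optControl μ K')) ω ∂μ -
        Q.apply θ (P.p K (P.optControl μ K) - P.p K' (P.optControl μ K'))) - (A e' - A' e')) -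
      P.rieszBadjL (A (e - e')) := by
    rw [he, he', smul_sub, smul_sub, smul_sub, hopt, hopt', P.quadControl_optimality K hco,
      P.quadControl_optimality K' hco, quadAdjoint, quadAdjoint, h1, h1', h4, h5, ← he, ← he', h2]
    simp only [← map_sub]
    congr 1
    abel
  refine (mul_norm_le_of_smul_eq_sub h6 (P.inner_quad_hessian_nonneg K hco _)).trans
    ((P.norm_rieszBadjL_le _).trans ?_)
  gcongr
  exact (norm_sub_le _ _).trans (by gcongr)

/-- The distance of two controls that are exact in the stochastic variable is controlled by the
distance of the adjoint variables at one of them. -/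
theorem norm_optControl_sub_optControl_le [CompleteSpace Z] {μ : Measure Ω}
    (P : ControlProblem Ω U V H Z W) (hco : ∀ᵐ ω ∂μ, IsCoercive (P.a ω))
    (K K' : Submodule ℝ V) [CompleteSpace K']
    (hopt : P.ν • P.optControl μ K = P.rieszBadjL (∫ ω, P.p K (P.optControl μ K) ω ∂μ))
    (hopt' : P.ν • P.optControl μ K' = P.rieszBadjL (∫ ω, P.p K' (P.optControl μ K') ω ∂μ))
    (hint : Integrable (P.p K (P.optControl μ K)) μ)
    (hint' : ∀ u, Integrable (P.p K' u) μ) :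
    P.ν * ‖P.optControl μ K - P.optControl μ K'‖ ≤
      ‖P.B‖ * ∫ ω, ‖P.p K (P.optControl μ K) ω - P.p K' (P.optControl μ K) ω‖ ∂μ := by
  set u := P.optControl μ K
  set u' := P.optControl μ K'
  have h1 : P.ν • (u - u') = P.rieszBadjL (∫ ω, (P.p K u ω - P.p K' u ω) ∂μ) -
      P.rieszBadjL (∫ ω, (P.p K' u' ω - P.p K' u ω) ∂μ) := by
    rw [smul_sub, hopt, hopt', integral_sub hint (hint' u), integral_sub (hint' u') (hint' u),
      ← map_sub, ← map_sub, sub_sub_sub_cancel_right]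
  refine (mul_norm_le_of_smul_eq_sub h1 ?_).trans ((P.norm_rieszBadjL_le _).trans ?_)
  · have hd : Integrable (fun ω => P.p K' u' ω - P.p K' u ω) μ := (hint' u').sub (hint' u)
    rw [inner_rieszBadjL, ← ContinuousLinearMap.integral_comp_comm _ hd]
    refine integral_nonneg_of_ae (hco.mono fun ω hω => ?_)
    simp only [Pi.zero_apply, P.B_apply_p_sub_p hω]
    exact real_inner_self_nonneg
  · gcongr
    exact norm_integral_le_integral_norm _

/-- By the optimality conditions, the multilevel control is a telescoping sum of discrete
optimal controls. -/
theorem multilevelControl_eq (P : ControlProblem Ω U V H Z W) (Vh : ℕ → Submodule ℝ V)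
    [∀ l, CompleteSpace (Vh l)] {Q : ℕ → RandomizedQuadrature Ω Θ} {θ : Θ}
    (hco : ∀ k j, IsCoercive (P.a ((Q k).node j θ))) (L : ℕ) :
    P.multilevelControl Vh Q L θ = P.quadControl (Vh 0) (Q L) θ +
      ∑ l ∈ Finset.Icc 1 L, (P.quadControl (Vh l) (Q (L - l)) θ -
        P.quadControl (Vh (l - 1)) (Q (L - l)) θ) := by
  have h (l k : ℕ) : (1 / P.ν) • P.rieszBadjL (P.quadAdjoint (Vh l) (Q k) θ) =
      P.quadControl (Vh l) (Q k) θ := by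
    rw [← P.quadControl_optimality (Vh l) (hco k), smul_smul, one_div_mul_cancel P.ν_pos.ne',
      one_smul]
  rw [multilevelControl, ← rieszBadjL_apply, map_add, map_sum, smul_add, Finset.smul_sum, h]
  simp only [map_sub, smul_sub, h]

end Deterministic

end ControlProblem

/-! ### Mean-square error estimates -/

theorem integrable_sq_and_integral_sq_le {Θ E : Type*} [MeasurableSpace Θ] {ρ : Measure Θ}
    [NormedAddCommGroup E] {f : Θ → E} (hf : AEStronglyMeasurable f ρ) {c : ℝ} (hc : 0 ≤ c)
    (h : eLpNorm f 2 ρ ≤ ENNReal.ofReal c) :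
    Integrable (fun θ => ‖f θ‖ ^ 2) ρ ∧ ∫ θ, ‖f θ‖ ^ 2 ∂ρ ≤ c ^ 2 := by
  have hm : MemLp f 2 ρ := ⟨hf, h.trans_lt ENNReal.ofReal_lt_top⟩
  refine ⟨(memLp_two_iff_integrable_sq_norm hf).1 hm, ?_⟩
  rw [hm.eLpNorm_eq_integral_rpow_norm two_ne_zero ENNReal.ofNat_ne_top,
    ENNReal.ofReal_le_ofReal_iff hc] at h
  simp only [ENNReal.toReal_ofNat, Real.rpow_two] at h
  have h0 : 0 ≤ ∫ θ, ‖f θ‖ ^ 2 ∂ρ := integral_nonneg fun _ => sq_nonneg _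
  calc ∫ θ, ‖f θ‖ ^ 2 ∂ρ = ((∫ θ, ‖f θ‖ ^ 2 ∂ρ) ^ (2 : ℝ)⁻¹) ^ 2 := by
        rw [← Real.rpow_natCast, ← Real.rpow_mul h0]; norm_num
    _ ≤ c ^ 2 := by gcongr

namespace ControlProblem

section Stochastic

variable {Ω U V H Z W : Type*} [MeasurableSpace Ω]
  [NormedAddCommGroup U] [InnerProductSpace ℝ U] [NormedAddCommGroup V] [InnerProductSpace ℝ V]
  [NormedAddCommGroup H] [InnerProductSpace ℝ H] [NormedAddCommGroup Z] [InnerProductSpace ℝ Z]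
  [NormedAddCommGroup W] [InnerProductSpace ℝ W] {μ : Measure Ω} {P : ControlProblem Ω U V H Z W}
  {Vh : ℕ → Submodule ℝ V} {Hq : ℝ → IntegrandSpace μ Z} {CH : ℝ → ℝ} {qbar α' : ℝ}

/-- The adjoint variables at the semi-discrete optimal controls are bounded in `H_q`, uniformly in
the level, since they approach the exact adjoint variable. -/
theorem MixedRegularity.exists_seminorm_le (h : P.MixedRegularity μ Vh Hq CH qbar α')
    (hα' : 0 ≤ α') {q : ℝ} (hq : 2 ≤ q) (hq' : q ≤ qbar) :
    ∃ G : ℝ, 0 ≤ G ∧ ∀ l, ∀ f : (Hq q).carrier,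
      (f : Ω → Z) = P.p (Vh l) (P.optControl μ (Vh l)) → (Hq q).seminorm f ≤ G := by
  set g : (Hq q).carrier := ⟨_, h.mem_exact (P.optControl μ ⊤) q hq hq'⟩ with hg
  refine ⟨(Hq q).seminorm g + |CH q| * (‖P.optControl μ ⊤‖ + ‖P.yd‖),
    add_nonneg (apply_nonneg _ _) (by positivity), fun l f hf => ?_⟩
  have h1 := h.norm_le q hq hq' l (g - f) (by rw [Submodule.coe_sub, hf])
  have h2 : CH q * meshSize l ^ α' * (‖P.optControl μ ⊤‖ + ‖P.yd‖) ≤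
      |CH q| * 1 * (‖P.optControl μ ⊤‖ + ‖P.yd‖) := by
    gcongr
    · exact Real.rpow_nonneg (meshSize_pos l).le _
    · exact le_abs_self _
    · exact Real.rpow_le_one (meshSize_pos l).le (meshSize_le_one l) hα'
  have h3 := map_sub_le_add (Hq q).seminorm g (g - f)
  rw [sub_sub_cancel] at h3
  linarith

/-- Mixed regularity of the differences between consecutive levels, by comparison with the exact
adjoint variable. -/
theorem MixedRegularity.exists_seminorm_sub_le (h : P.MixedRegularity μ Vh Hq CH qbar α')
    {q : ℝ} (hq : 2 ≤ q) (hq' : q ≤ qbar) :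
    ∃ G : ℝ, 0 ≤ G ∧ ∀ l, 1 ≤ l → ∀ f : (Hq q).carrier,
      (f : Ω → Z) = P.p (Vh l) (P.optControl μ (Vh l)) -
        P.p (Vh (l - 1)) (P.optControl μ (Vh (l - 1))) →
      (Hq q).seminorm f ≤ G * meshSize l ^ α' := by
  refine ⟨|CH q| * (2 ^ α' + 1) * (‖P.optControl μ ⊤‖ + ‖P.yd‖), by positivity,
    fun l hl f hf => ?_⟩
  let e : ℕ → (Hq q).carrier := fun k =>
    ⟨P.p ⊤ (P.optControl μ ⊤) - P.p (Vh k) (P.optControl μ (Vh k)),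
      (Hq q).carrier.sub_mem (h.mem_exact _ q hq hq') (h.mem_discrete _ q hq hq' k)⟩
  have he : ∀ k, (Hq q).seminorm (e k) ≤
      |CH q| * meshSize k ^ α' * (‖P.optControl μ ⊤‖ + ‖P.yd‖) := fun k => by
    refine (h.norm_le q hq hq' k (e k) rfl).trans ?_
    gcongr
    · exact Real.rpow_nonneg (meshSize_pos k).le _
    · exact le_abs_self _
  have hfe : f = e (l - 1) - e l := Subtype.ext (by
    rw [hf, Submodule.coe_sub]
    simp only [e]
    abel)
  have h1 := map_sub_le_add (Hq q).seminorm (e (l - 1)) (e l)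
  have h2 := he (l - 1)
  rw [meshSize_rpow_pred hl] at h2
  rw [hfe]
  linarith [he l]

end Stochastic

end ControlProblem

theorem meshSize_rpow_sq (l : ℕ) (a : ℝ) : (meshSize l ^ a) ^ 2 = meshSize l ^ (2 * a) := by
  rw [← Real.rpow_natCast, ← Real.rpow_mul (meshSize_pos l).le, mul_comm]
  norm_num

theorem sum_Icc_one_eq_sum_range {E : Type*} [AddCommMonoid E] (f : ℕ → E) (L : ℕ) :
    ∑ l ∈ Finset.Icc 1 L, f l = ∑ i ∈ Finset.range L, f (i + 1) := by
  induction L with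
  | zero => simp
  | succ n ih => rw [Finset.sum_Icc_succ_top (by omega), ih, Finset.sum_range_succ]

namespace ControlProblem

section Stochastic

variable {Ω U V H Z W : Type*} [MeasurableSpace Ω]
  [NormedAddCommGroup U] [InnerProductSpace ℝ U] [NormedAddCommGroup V] [InnerProductSpace ℝ V]
  [NormedAddCommGroup H] [InnerProductSpace ℝ H] [NormedAddCommGroup Z] [InnerProductSpace ℝ Z]
  [NormedAddCommGroup W] [InnerProductSpace ℝ W] {μ : Measure Ω} {P : ControlProblem Ω U V H Z W}
  {Vh : ℕ → Submodule ℝ V} {Hq : ℝ → IntegrandSpace μ Z} {Cq CH : ℝ → ℝ} {qbar α' : ℝ}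

theorem MixedRegularity.integrable_exact (h : P.MixedRegularity μ Vh Hq CH qbar α')
    (hqbar : 2 ≤ qbar) (u : U) : Integrable (P.p ⊤ u) μ :=
  (Hq 2).integrable _ (h.mem_exact u 2 le_rfl hqbar)

theorem MixedRegularity.integrable_discrete (h : P.MixedRegularity μ Vh Hq CH qbar α')
    (hqbar : 2 ≤ qbar) (l : ℕ) (u : U) : Integrable (P.p (Vh l) u) μ :=
  (Hq 2).integrable _ (h.mem_discrete u 2 le_rfl hqbar l)

variable [CompleteSpace U] [CompleteSpace Z] [IsProbabilityMeasure μ]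

/-- `L^q` bound of the quadrature error of the control, uniform in the spatial level. -/
theorem exists_eLpNorm_quadControl_error_le (hco : ∀ᵐ ω ∂μ, IsCoercive (P.a ω))
    [∀ l, FiniteDimensional ℝ (Vh l)] (hα' : 0 ≤ α')
    (hmix : P.MixedRegularity μ Vh Hq CH qbar α') (Cq : ℝ → ℝ) {q : ℝ} (hq : 2 ≤ q)
    (hq' : q ≤ qbar) :
    ∃ M : ℝ, 0 ≤ M ∧ ∀ (Θ : Type*) [MeasurableSpace Θ] (ρ : Measure Θ) (γ : ℕ → ℝ)
      (Q : ℕ → RandomizedQuadrature Ω Θ), (∀ k, 0 ≤ γ k) → QuadratureAssumption μ ρ Hq Cq γ Q →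
      ∀ l k, eLpNorm (fun θ => P.optControl μ (Vh l) - P.quadControl (Vh l) (Q k) θ)
        (ENNReal.ofReal q) ρ ≤ ENNReal.ofReal (M * γ k) := by
  obtain ⟨G, hG0, hG⟩ := hmix.exists_seminorm_le hα' hq hq'
  have hν := P.ν_pos
  refine ⟨P.ν⁻¹ * ‖P.B‖ * (|Cq q| * G), by positivity, fun Θ _ ρ γ Q hγ hQ l k => ?_⟩
  have : CompleteSpace (Vh l) := FiniteDimensional.complete ℝ _
  have hint := hmix.integrable_discrete (hq.trans hq') l
  have hpt : ∀ᵐ θ ∂ρ, ‖P.optControl μ (Vh l) - P.quadControl (Vh l) (Q k) θ‖ ≤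
      P.ν⁻¹ * ‖P.B‖ * ‖∫ ω, P.p (Vh l) (P.optControl μ (Vh l)) ω ∂μ -
        (Q k).apply θ (P.p (Vh l) (P.optControl μ (Vh l)))‖ := by
    filter_upwards [(hQ.unbiased k).ae_node hco] with θ hθ
    rw [mul_assoc, ← div_eq_inv_mul, le_div_iff₀' hν]
    exact P.norm_optControl_sub_quadControl_le (Vh l) hθ (P.optControl_optimality hco _ hint)
  have hmem := hmix.mem_discrete (P.optControl μ (Vh l)) q hq hq' l
  refine (eLpNorm_le_mul_eLpNorm_of_ae_le_mul hpt _).trans ?_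
  rw [mul_assoc (P.ν⁻¹ * ‖P.B‖), ENNReal.ofReal_mul (p := P.ν⁻¹ * ‖P.B‖) (by positivity)]
  gcongr
  refine (hQ.error_le q hq k ⟨_, hmem⟩).trans (ENNReal.ofReal_le_ofReal ?_)
  rw [mul_right_comm]
  refine mul_le_mul_of_nonneg_right ?_ (hγ k)
  exact mul_le_mul (le_abs_self _) (hG l _ rfl) (apply_nonneg _ _) (abs_nonneg _)

/-- Mean-square bound of the difference of the quadrature errors on two consecutive levels:
the product of the rates in space and in the stochastic variable. Hölder's inequality separates
the random discretization constant from the control error, which takes the integrability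
exponent `qbar > 2`. -/
theorem exists_eLpNorm_quadControl_error_sub_le [CompleteSpace V] (hP : P.WellPosed μ)
    [∀ l, FiniteDimensional ℝ (Vh l)] {αW αZ : ℝ} (hα : 0 ≤ min αW αZ) (hα' : 0 ≤ α')
    (hFEM : P.FEMAssumption μ Vh αW αZ) (hqbar : 2 < qbar)
    (hmix : P.MixedRegularity μ Vh Hq CH qbar α') (Cq : ℝ → ℝ) :
    ∃ M : ℝ, 0 ≤ M ∧ ∀ (Θ : Type*) [MeasurableSpace Θ] (ρ : Measure Θ) (γ : ℕ → ℝ)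
      (Q : ℕ → RandomizedQuadrature Ω Θ), (∀ k, 0 ≤ γ k) → QuadratureAssumption μ ρ Hq Cq γ Q →
      ∀ l k, 1 ≤ l → eLpNorm (fun θ =>
        (P.optControl μ (Vh l) - P.quadControl (Vh l) (Q k) θ) -
          (P.optControl μ (Vh (l - 1)) - P.quadControl (Vh (l - 1)) (Q k) θ)) 2 ρ ≤
        ENNReal.ofReal (M * meshSize l ^ (min (min αW αZ) α') * γ k) := by
  have hco := hP.coercive
  have hν := P.ν_pos
  have hcpl : ∀ l, CompleteSpace (Vh l) := fun l => FiniteDimensional.complete ℝ _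
  obtain ⟨D, hDm, hD0, hD⟩ := exists_adjoint_error_bound hP hα hFEM
  obtain ⟨G, hG0, hG⟩ := hmix.exists_seminorm_sub_le le_rfl hqbar.le
  obtain ⟨M₁, hM₁0, hM₁⟩ := exists_eLpNorm_quadControl_error_le hco hα' hmix Cq hqbar.le le_rfl
  have hp := hmix.integrable_discrete hqbar.le
  -- The exponent conjugate to `qbar` with respect to `2`.
  set s : ℝ := 2 * qbar / (qbar - 2) with hs
  have hq2 : 0 < qbar - 2 := by linarith
  have hs1 : 1 ≤ s := by rw [hs, le_div_iff₀ hq2]; linarith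
  have hHolder : ENNReal.HolderTriple (ENNReal.ofReal s) (ENNReal.ofReal qbar) 2 := ⟨by
    rw [← ENNReal.ofReal_inv_of_pos (by linarith), ← ENNReal.ofReal_inv_of_pos (by linarith),
      ← ENNReal.ofReal_add (by positivity) (by positivity), ← ENNReal.ofReal_ofNat,
      ← ENNReal.ofReal_inv_of_pos (by norm_num)]
    congr 1
    rw [hs]
    field_simp
    ring⟩
  set α := min αW αZ with hαdef
  set d : ℝ := (eLpNorm D (ENNReal.ofReal s) μ).toReal with hd
  have hdD : eLpNorm D (ENNReal.ofReal s) μ = ENNReal.ofReal d :=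
    (ENNReal.ofReal_toReal (hDm s hs1).eLpNorm_ne_top).symm
  have hd0 : 0 ≤ d := ENNReal.toReal_nonneg
  refine ⟨P.ν⁻¹ * ‖P.B‖ * (|Cq 2| * G + (1 + 2 ^ α) * (d * M₁)), by positivity,
    fun Θ _ ρ γ Q hγ hQ l k hl => ?_⟩
  have hQu := hQ.unbiased k
  set c : ℝ := (1 + 2 ^ α) * meshSize l ^ α with hc
  have hc0 : 0 ≤ c := mul_nonneg (by positivity) (Real.rpow_nonneg (meshSize_pos l).le _)
  set f : Ω → Z := P.p (Vh l) (P.optControl μ (Vh l)) -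
        P.p (Vh (l - 1)) (P.optControl μ (Vh (l - 1))) with hf
  have hfm : Integrable f μ := (hp l _).sub (hp (l - 1) _)
  set E : Θ → Z := fun θ => ∫ ω, f ω ∂μ - (Q k).apply θ f with hE
  set e : Θ → U := fun θ => P.optControl μ (Vh (l - 1)) - P.quadControl (Vh (l - 1)) (Q k) θ
    with he
  set QD : Θ → ℝ := fun θ => (Q k).apply θ fun ω => D ω * c with hQD
  have hEm : AEStronglyMeasurable E ρ :=
    aestronglyMeasurable_const.sub (hQu.aestronglyMeasurable_apply hfm.1)
  have hem : AEStronglyMeasurable e ρ := aestronglyMeasurable_const.sub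
    (P.aestronglyMeasurable_quadControl hco _ (fun u => (hp (l - 1) u).1) hQu)
  have hDcm : AEStronglyMeasurable (fun ω => D ω * c) μ :=
    (hDm 1 le_rfl).1.mul aestronglyMeasurable_const
  have hQDm : AEStronglyMeasurable QD ρ := hQu.aestronglyMeasurable_apply hDcm
  have hpt : ∀ᵐ θ ∂ρ, ‖(P.optControl μ (Vh l) - P.quadControl (Vh l) (Q k) θ) -
      (P.optControl μ (Vh (l - 1)) - P.quadControl (Vh (l - 1)) (Q k) θ)‖ ≤
        P.ν⁻¹ * ‖P.B‖ * ‖(fun θ => ‖E θ‖ + (QD • fun θ => ‖e θ‖) θ) θ‖ := by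
    filter_upwards [hQu.ae_node hD] with θ hθ
    refine le_trans ?_ (mul_le_mul_of_nonneg_left (le_abs_self _) (by positivity))
    rw [mul_assoc, ← div_eq_inv_mul, le_div_iff₀' hν]
    refine P.norm_optControl_sub_quadControl_sub_le (Vh l) (Vh (l - 1)) (fun j => (hθ j).1)
      (P.optControl_optimality hco _ (hp l)) (P.optControl_optimality hco _ (hp (l - 1)))
      (hp l _) (hp (l - 1) _) fun j x => ?_
    have h1 := ((hθ j).2 l x).2
    have h2 := ((hθ j).2 (l - 1) x).2
    rw [meshSize_rpow_pred hl] at h2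
    rw [norm_sub_rev] at h1
    refine (norm_sub_le_norm_sub_add_norm_sub _ (P.adjointObservation ⊤ ((Q k).node j θ)
      (P.observation ⊤ ((Q k).node j θ) x)) _).trans ((add_le_add h1 h2).trans_eq ?_)
    rw [hc]; ring
  refine (eLpNorm_le_mul_eLpNorm_of_ae_le_mul hpt _).trans ?_
  have hb : meshSize l ^ α ≤ meshSize l ^ min α α' :=
    meshSize_rpow_le_rpow (min_le_left _ _) l
  have hb' : meshSize l ^ α' ≤ meshSize l ^ min α α' :=
    meshSize_rpow_le_rpow (min_le_right _ _) l
  have h1 : eLpNorm (fun θ => ‖E θ‖) 2 ρ ≤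
      ENNReal.ofReal (|Cq 2| * G * meshSize l ^ min α α' * γ k) := by
    rw [eLpNorm_norm, ← ENNReal.ofReal_ofNat]
    refine (hQ.error_le 2 le_rfl k ⟨f, (Hq 2).carrier.sub_mem
      (hmix.mem_discrete _ 2 le_rfl hqbar.le l)
      (hmix.mem_discrete _ 2 le_rfl hqbar.le (l - 1))⟩).trans (ENNReal.ofReal_le_ofReal ?_)
    rw [mul_right_comm, mul_assoc |Cq 2|]
    refine mul_le_mul_of_nonneg_right ?_ (hγ k)
    exact mul_le_mul (le_abs_self _) ((hG l hl _ rfl).trans (by gcongr)) (apply_nonneg _ _)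
      (abs_nonneg _)
  have h2 : eLpNorm (QD • fun θ => ‖e θ‖) 2 ρ ≤
      ENNReal.ofReal ((1 + 2 ^ α) * (d * M₁) * meshSize l ^ min α α' * γ k) := by
    have h3 : eLpNorm QD (ENNReal.ofReal s) ρ ≤ ENNReal.ofReal (d * c) := by
      have hX : MemLp (fun ω => D ω * c) (ENNReal.ofReal s) μ := by
        simpa only [mul_comm] using (hDm s hs1).const_mul c
      refine (hQu.eLpNorm_apply_le (fun ω => mul_nonneg (hD0 ω) hc0) hs1 hX).trans ?_
      rw [mul_comm d, ENNReal.ofReal_mul hc0, ← hdD]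
      refine eLpNorm_le_mul_eLpNorm_of_ae_le_mul (Filter.Eventually.of_forall fun ω => ?_) _
      rw [norm_mul, Real.norm_of_nonneg hc0, mul_comm]
    calc eLpNorm (QD • fun θ => ‖e θ‖) 2 ρ
        ≤ eLpNorm QD (ENNReal.ofReal s) ρ * eLpNorm (fun θ => ‖e θ‖) (ENNReal.ofReal qbar) ρ :=
          eLpNorm_smul_le_mul_eLpNorm hem.norm hQDm
      _ ≤ ENNReal.ofReal (d * c) * ENNReal.ofReal (M₁ * γ k) := by
          rw [eLpNorm_norm]
          gcongr
          exact hM₁ Θ ρ γ Q hγ hQ (l - 1) k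
      _ ≤ _ := by
          rw [← ENNReal.ofReal_mul (by positivity)]
          refine ENNReal.ofReal_le_ofReal ?_
          have := hγ k
          calc d * c * (M₁ * γ k) = (1 + 2 ^ α) * (d * M₁) * meshSize l ^ α * γ k := by
                rw [hc]; ring
            _ ≤ _ := by gcongr
  have hb0 : 0 ≤ meshSize l ^ min α α' := Real.rpow_nonneg (meshSize_pos l).le _
  have hγk := hγ k
  calc ENNReal.ofReal (P.ν⁻¹ * ‖P.B‖) *
        eLpNorm (fun θ => ‖E θ‖ + (QD • fun θ => ‖e θ‖) θ) 2 ρ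
      ≤ ENNReal.ofReal (P.ν⁻¹ * ‖P.B‖) *
        (ENNReal.ofReal (|Cq 2| * G * meshSize l ^ min α α' * γ k) +
          ENNReal.ofReal ((1 + 2 ^ α) * (d * M₁) * meshSize l ^ min α α' * γ k)) := by
        gcongr
        exact (eLpNorm_add_le hEm.norm (hQDm.smul hem.norm) (by norm_num)).trans
          (add_le_add h1 h2)
    _ = _ := by
        rw [← ENNReal.ofReal_add (by positivity) (by positivity),
          ← ENNReal.ofReal_mul (by positivity)]
        congr 1
        ring

/-- The spatial discretization error of the control. -/
theorem exists_norm_optControl_sub_le [CompleteSpace V] (hP : P.WellPosed μ)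
    [∀ l, FiniteDimensional ℝ (Vh l)] {αW αZ : ℝ} (hα : 0 ≤ min αW αZ)
    (hFEM : P.FEMAssumption μ Vh αW αZ) (hqbar : 2 ≤ qbar)
    (hmix : P.MixedRegularity μ Vh Hq CH qbar α') :
    ∃ C : ℝ, 0 ≤ C ∧ ∀ l,
      ‖P.optControl μ ⊤ - P.optControl μ (Vh l)‖ ≤ C * meshSize l ^ min αW αZ := by
  have hco := hP.coercive
  have hν := P.ν_pos
  have hcpl : ∀ l, CompleteSpace (Vh l) := fun l => FiniteDimensional.complete ℝ _
  have : CompleteSpace (⊤ : Submodule ℝ V) :=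
    completeSpace_coe_iff_isComplete.2 (by simpa using isClosed_univ.isComplete)
  obtain ⟨D, hDm, hD0, hD⟩ := exists_adjoint_error_bound hP hα hFEM
  have hpe := hmix.integrable_exact hqbar
  have hp := hmix.integrable_discrete hqbar
  have hDi : Integrable D μ := memLp_one_iff_integrable.1 (by simpa using hDm 1 le_rfl)
  refine ⟨P.ν⁻¹ * (‖P.B‖ * ((∫ ω, D ω ∂μ) * (‖P.yd‖ + ‖P.optControl μ ⊤‖))),
    mul_nonneg (inv_nonneg.2 hν.le) (mul_nonneg (norm_nonneg P.B)
      (mul_nonneg (integral_nonneg hD0) (by positivity))), fun l => ?_⟩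
  have h1 := P.norm_optControl_sub_optControl_le hco ⊤ (Vh l) (P.optControl_optimality hco _ hpe)
    (P.optControl_optimality hco _ (hp l)) (hpe _) (hp l)
  have h2 : ∫ ω, ‖P.p ⊤ (P.optControl μ ⊤) ω - P.p (Vh l) (P.optControl μ ⊤) ω‖ ∂μ ≤
      ∫ ω, D ω * (meshSize l ^ min αW αZ * (‖P.yd‖ + ‖P.optControl μ ⊤‖)) ∂μ :=
    integral_mono_ae ((hpe _).sub (hp l _)).norm (hDi.mul_const _) (hD.mono fun ω hω => by
      simpa only [mul_assoc] using (hω.2 l (P.optControl μ ⊤)).1)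
  rw [integral_mul_const] at h2
  rw [mul_assoc, ← div_eq_inv_mul, le_div_iff₀' hν]
  refine h1.trans ((mul_le_mul_of_nonneg_left h2 (norm_nonneg P.B)).trans_eq ?_)
  ring

/-- The mean-square error of the multilevel quadrature approximation. -/
theorem exists_multilevel_error_le [CompleteSpace V] (hP : P.WellPosed μ)
    [∀ l, FiniteDimensional ℝ (Vh l)] {αW αZ : ℝ} (hα : 0 ≤ min αW αZ) (hα' : 0 ≤ α')
    (hFEM : P.FEMAssumption μ Vh αW αZ) (hqbar : 2 < qbar)
    (hmix : P.MixedRegularity μ Vh Hq CH qbar α') (Cq : ℝ → ℝ) :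
    ∃ C₁₀ C₃₀ : ℝ, 0 ≤ C₁₀ ∧ 0 ≤ C₃₀ ∧ ∀ C₁ C₃ : ℝ, C₁₀ ≤ C₁ → C₃₀ ≤ C₃ →
      ∀ (Θ : Type*) [MeasurableSpace Θ] (ρ : Measure Θ) [IsProbabilityMeasure ρ] (γ : ℕ → ℝ)
      (Q : ℕ → RandomizedQuadrature Ω Θ), (∀ k, 0 ≤ γ k) → QuadratureAssumption μ ρ Hq Cq γ Q →
      ∀ L : ℕ, 1 ≤ L →
        Integrable (fun θ => ‖P.optControl μ ⊤ - P.multilevelControl Vh Q L θ‖ ^ 2) ρ ∧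
        ∫ θ, ‖P.optControl μ ⊤ - P.multilevelControl Vh Q L θ‖ ^ 2 ∂ρ ≤
          2 * C₁ ^ 2 * meshSize L ^ (2 * min αW αZ) +
            C₃ ^ 2 * L * ∑ l ∈ Finset.range (L + 1),
              meshSize l ^ (2 * min (min αW αZ) α') * γ (L - l) ^ 2 := by
  have hco := hP.coercive
  have hcpl : ∀ l, CompleteSpace (Vh l) := fun l => FiniteDimensional.complete ℝ _
  have hp := hmix.integrable_discrete hqbar.le
  obtain ⟨C, hC0, hC⟩ := exists_norm_optControl_sub_le hP hα hFEM hqbar.le hmix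
  obtain ⟨M₁, hM₁0, hM₁⟩ := exists_eLpNorm_quadControl_error_le hco hα' hmix Cq le_rfl hqbar.le
  obtain ⟨M₂, hM₂0, hM₂⟩ :=
    exists_eLpNorm_quadControl_error_sub_le hP hα hα' hFEM hqbar hmix Cq
  refine ⟨C, 2 * (M₁ + M₂), hC0, by positivity, fun C₁ C₃ hC₁ hC₃ Θ _ ρ _ γ Q hγ hQ L hL => ?_⟩
  set β := min (min αW αZ) α'
  set M := M₁ + M₂
  have hb0 : ∀ l, 0 ≤ meshSize l ^ β := fun l => Real.rpow_nonneg (meshSize_pos l).le _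
  let e : ℕ → ℕ → Θ → U := fun l k θ => P.optControl μ (Vh l) - P.quadControl (Vh l) (Q k) θ
  have hem : ∀ l k, AEStronglyMeasurable (e l k) ρ := fun l k => aestronglyMeasurable_const.sub
    (P.aestronglyMeasurable_quadControl hco _ (fun u => (hp l u).1) (hQ.unbiased k))
  let X : ℕ → Θ → U := fun l => match l with
    | 0 => e 0 L
    | l + 1 => fun θ => e (l + 1) (L - (l + 1)) θ - e l (L - (l + 1)) θ
  have hX : ∀ l, AEStronglyMeasurable (X l) ρ ∧
      eLpNorm (X l) 2 ρ ≤ ENNReal.ofReal (M * meshSize l ^ β * γ (L - l)) := by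
    intro l
    cases l with
    | zero =>
      refine ⟨hem 0 L, ?_⟩
      have h1 := hM₁ Θ ρ γ Q hγ hQ 0 L
      rw [ENNReal.ofReal_ofNat] at h1
      refine h1.trans (ENNReal.ofReal_le_ofReal ?_)
      have : meshSize 0 ^ β = 1 := by simp [meshSize]
      rw [this, mul_one, Nat.sub_zero]
      exact mul_le_mul_of_nonneg_right (by linarith) (hγ L)
    | succ l =>
      refine ⟨(hem _ _).sub (hem _ _), ?_⟩
      refine (hM₂ Θ ρ γ Q hγ hQ (l + 1) (L - (l + 1)) (by omega)).trans
        (ENNReal.ofReal_le_ofReal ?_)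
      exact mul_le_mul_of_nonneg_right
        (mul_le_mul_of_nonneg_right (by linarith) (hb0 _)) (hγ _)
  have hX2 := fun l => integrable_sq_and_integral_sq_le (hX l).1
    (mul_nonneg (mul_nonneg (by positivity) (hb0 l)) (hγ (L - l))) (hX l).2
  set a := P.optControl μ ⊤ - P.optControl μ (Vh L) with ha
  have hdec : ∀ᵐ θ ∂ρ, P.optControl μ ⊤ - P.multilevelControl Vh Q L θ =
      a + ∑ l ∈ Finset.range (L + 1), X l θ := by
    filter_upwards [ae_all_iff.2 fun k => (hQ.unbiased k).ae_node hco] with θ hθ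
    rw [P.multilevelControl_eq Vh hθ, sum_Icc_one_eq_sum_range, Finset.sum_range_succ']
    have h1 : ∑ i ∈ Finset.range L, X (i + 1) θ =
        ∑ i ∈ Finset.range L, (P.optControl μ (Vh (i + 1)) - P.optControl μ (Vh i)) -
        ∑ i ∈ Finset.range L, (P.quadControl (Vh (i + 1)) (Q (L - (i + 1))) θ -
          P.quadControl (Vh (i + 1 - 1)) (Q (L - (i + 1))) θ) := by
      rw [← Finset.sum_sub_distrib]
      refine Finset.sum_congr rfl fun i _ => ?_
      simp only [X, e, Nat.add_sub_cancel]
      abel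
    rw [h1, Finset.sum_range_sub (fun i => P.optControl μ (Vh i))]
    simp only [X, e, ha]
    abel
  have hbound : ∀ᵐ θ ∂ρ, ‖P.optControl μ ⊤ - P.multilevelControl Vh Q L θ‖ ^ 2 ≤
      2 * ‖a‖ ^ 2 + 2 * (L + 1) * ∑ l ∈ Finset.range (L + 1), ‖X l θ‖ ^ 2 := by
    filter_upwards [hdec] with θ hθ
    rw [hθ]
    have h1 : ‖∑ l ∈ Finset.range (L + 1), X l θ‖ ^ 2 ≤
        (L + 1) * ∑ l ∈ Finset.range (L + 1), ‖X l θ‖ ^ 2 := by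
      calc _ ≤ (∑ l ∈ Finset.range (L + 1), ‖X l θ‖) ^ 2 := by
            gcongr
            exact norm_sum_le _ _
        _ ≤ _ := by
            have := sq_sum_le_card_mul_sum_sq (s := Finset.range (L + 1)) (f := fun l => ‖X l θ‖)
            simpa using this
    have h2 : ‖a + ∑ l ∈ Finset.range (L + 1), X l θ‖ ^ 2 ≤
        (‖a‖ + ‖∑ l ∈ Finset.range (L + 1), X l θ‖) ^ 2 := by
      gcongr
      exact norm_add_le _ _
    nlinarith [sq_nonneg (‖a‖ - ‖∑ l ∈ Finset.range (L + 1), X l θ‖)]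
  have hsum : Integrable (fun θ => ∑ l ∈ Finset.range (L + 1), ‖X l θ‖ ^ 2) ρ :=
    integrable_finsetSum _ fun l _ => (hX2 l).1
  have hrhs : Integrable (fun θ => 2 * ‖a‖ ^ 2 +
      2 * (L + 1) * ∑ l ∈ Finset.range (L + 1), ‖X l θ‖ ^ 2) ρ :=
    (integrable_const _).add (hsum.const_mul _)
  have hmeas : AEStronglyMeasurable
      (fun θ => P.optControl μ ⊤ - P.multilevelControl Vh Q L θ) ρ :=
    (aestronglyMeasurable_const.add (Finset.aestronglyMeasurable_fun_sum _ fun l _ =>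
      (hX l).1)).congr (hdec.mono fun θ hθ => hθ.symm)
  have hint : Integrable (fun θ => ‖P.optControl μ ⊤ - P.multilevelControl Vh Q L θ‖ ^ 2) ρ :=
    hrhs.mono' (hmeas.norm.pow 2) (hbound.mono fun θ hθ => by
      rwa [Real.norm_of_nonneg (sq_nonneg _)])
  refine ⟨hint, (integral_mono_ae hint hrhs hbound).trans ?_⟩
  rw [integral_add (integrable_const _) (hsum.const_mul _),
    integral_const_mul (2 * ((L : ℝ) + 1)) fun θ => ∑ l ∈ Finset.range (L + 1), ‖X l θ‖ ^ 2,
    integral_finsetSum _ fun l _ => (hX2 l).1]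
  simp only [integral_const, probReal_univ, one_smul]
  refine add_le_add ?_ ?_
  · rw [mul_assoc, ← meshSize_rpow_sq, ← mul_pow]
    have h1 : ‖a‖ ≤ C₁ * meshSize L ^ min αW αZ :=
      (hC L).trans (mul_le_mul_of_nonneg_right hC₁ (Real.rpow_nonneg (meshSize_pos L).le _))
    gcongr
  · have h1 : ∑ l ∈ Finset.range (L + 1), ∫ θ, ‖X l θ‖ ^ 2 ∂ρ ≤
        M ^ 2 * ∑ l ∈ Finset.range (L + 1), meshSize l ^ (2 * β) * γ (L - l) ^ 2 := by
      rw [Finset.mul_sum]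
      refine Finset.sum_le_sum fun l _ => (hX2 l).2.trans_eq ?_
      rw [← meshSize_rpow_sq]; ring
    have hS : 0 ≤ ∑ l ∈ Finset.range (L + 1), meshSize l ^ (2 * β) * γ (L - l) ^ 2 :=
      Finset.sum_nonneg fun l _ => mul_nonneg (Real.rpow_nonneg (meshSize_pos l).le _)
        (sq_nonneg _)
    have hL' : (1 : ℝ) ≤ L := by exact_mod_cast hL
    calc _ ≤ 2 * ((L : ℝ) + 1) * (M ^ 2 *
          ∑ l ∈ Finset.range (L + 1), meshSize l ^ (2 * β) * γ (L - l) ^ 2) := by gcongr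
      _ ≤ 2 * ((L : ℝ) + L) * (M ^ 2 *
          ∑ l ∈ Finset.range (L + 1), meshSize l ^ (2 * β) * γ (L - l) ^ 2) := by gcongr
      _ = (2 * M) ^ 2 * L *
          ∑ l ∈ Finset.range (L + 1), meshSize l ^ (2 * β) * γ (L - l) ^ 2 := by ring
      _ ≤ _ := by gcongr

end Stochastic

end ControlProblem

/-! ### Optimal numbers of quadrature points -/

section Points

variable (D : ℕ → ℕ) (β η C₃ ε : ℝ) (L : ℕ)

/-- The sum over the spatial levels `j ≤ L` of `h_j^{2β/(2η+1)} D_j^{2η/(2η+1)}`. -/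
noncomputable def levelSum : ℝ :=
  ∑ j ∈ Finset.range (L + 1), meshSize j ^ (2 * β / (2 * η + 1)) *
    (D j : ℝ) ^ (2 * η / (2 * η + 1))

/-- The real number that `numPoints` rounds up; it solves the problem of minimizing
`∑ D_l x_l` for a prescribed value of `∑ h_l^{2β} x_l^{-2η}`. -/
noncomputable def realPoints (l : ℕ) : ℝ :=
  (Real.sqrt (2 * L * C₃ ^ 2) * ε⁻¹) ^ (1 / η) * meshSize l ^ (2 * β / (2 * η + 1)) *
    (D l : ℝ) ^ (-1 / (2 * η + 1)) * levelSum D β η L ^ (1 / (2 * η))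

theorem numPoints_eq_ceil (l : ℕ) :
    numPoints D β η C₃ ε L l = ⌈realPoints D β η C₃ ε L l⌉₊ := rfl

variable {D β η C₃ ε L}

theorem levelSum_pos (hD : ∀ j, 0 < D j) : 0 < levelSum D β η L :=
  Finset.sum_pos (fun j _ => mul_pos (Real.rpow_pos_of_pos (meshSize_pos j) _)
    (Real.rpow_pos_of_pos (by exact_mod_cast hD j) _)) ⟨0, by simp⟩

theorem sqrt_mul_inv_pos (hL : 1 ≤ L) (hC₃ : 0 < C₃) (hε : 0 < ε) :
    0 < Real.sqrt (2 * L * C₃ ^ 2) * ε⁻¹ := by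
  have : (0 : ℝ) < L := by exact_mod_cast hL
  positivity

theorem realPoints_pos (hD : ∀ j, 0 < D j) (hL : 1 ≤ L) (hC₃ : 0 < C₃) (hε : 0 < ε) (l : ℕ) :
    0 < realPoints D β η C₃ ε L l := by
  have h1 := sqrt_mul_inv_pos hL hC₃ hε
  have h2 := levelSum_pos (β := β) (η := η) (L := L) hD
  have h3 := meshSize_pos l
  have h4 : (0 : ℝ) < D l := by exact_mod_cast hD l
  unfold realPoints
  positivity

theorem dim_mul_realPoints (hD : ∀ j, 0 < D j) (hη : 0 < η) (l : ℕ) :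
    D l * realPoints D β η C₃ ε L l =
      (Real.sqrt (2 * L * C₃ ^ 2) * ε⁻¹) ^ (1 / η) * levelSum D β η L ^ (1 / (2 * η)) *
        (meshSize l ^ (2 * β / (2 * η + 1)) * (D l : ℝ) ^ (2 * η / (2 * η + 1))) := by
  have h4 : (0 : ℝ) < D l := by exact_mod_cast hD l
  have h5 : (D l : ℝ) ^ (2 * η / (2 * η + 1)) = D l * (D l : ℝ) ^ (-1 / (2 * η + 1)) := by
    conv_rhs => rw [← Real.rpow_one_add' h4.le (by
      rw [show 1 + -1 / (2 * η + 1) = 2 * η / (2 * η + 1) by field_simp; ring]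
      positivity)]
    congr 1
    field_simp
    ring
  rw [h5, realPoints]
  ring

theorem sum_dim_mul_realPoints (hD : ∀ j, 0 < D j) (hη : 0 < η) :
    ∑ l ∈ Finset.range (L + 1), D l * realPoints D β η C₃ ε L l =
      (Real.sqrt (2 * L * C₃ ^ 2) * ε⁻¹) ^ (1 / η) *
        levelSum D β η L ^ (1 + 1 / (2 * η)) := by
  simp only [dim_mul_realPoints hD hη]
  rw [← Finset.mul_sum, Real.rpow_one_add' (levelSum_pos hD).le (by positivity), ← levelSum]
  ring

/-- Each level contributes to the stochastic error at most the share of `ε²/2` that its summand has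
in `levelSum`. -/
theorem stochastic_error_numPoints_le (hD : ∀ j, 0 < D j) (hη : 0 < η) (hL : 1 ≤ L)
    (hC₃ : 0 < C₃) (hε : 0 < ε) :
    C₃ ^ 2 * L * ∑ l ∈ Finset.range (L + 1),
      meshSize l ^ (2 * β) * ((numPoints D β η C₃ ε L l : ℝ) ^ (-η)) ^ 2 ≤ ε ^ 2 / 2 := by
  set K := Real.sqrt (2 * L * C₃ ^ 2) * ε⁻¹ with hK
  have hK0 : 0 < K := sqrt_mul_inv_pos hL hC₃ hε
  have hS := levelSum_pos (β := β) (η := η) (L := L) hD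
  have hL0 : (0 : ℝ) < L := by exact_mod_cast hL
  have key : ∀ l, meshSize l ^ (2 * β) * ((numPoints D β η C₃ ε L l : ℝ) ^ (-η)) ^ 2 ≤
      (K ^ 2)⁻¹ * (levelSum D β η L)⁻¹ *
        (meshSize l ^ (2 * β / (2 * η + 1)) * (D l : ℝ) ^ (2 * η / (2 * η + 1))) := by
    intro l
    have hx := realPoints_pos (β := β) (η := η) hD hL hC₃ hε l
    have hd : (0 : ℝ) < D l := by exact_mod_cast hD l
    have hm := meshSize_pos l
    have h1 : ((numPoints D β η C₃ ε L l : ℝ) ^ (-η)) ^ 2 ≤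
        realPoints D β η C₃ ε L l ^ (-(2 * η)) := by
      rw [← Real.rpow_natCast, ← Real.rpow_mul (Nat.cast_nonneg _),
        show -η * ((2 : ℕ) : ℝ) = -(2 * η) by push_cast; ring]
      refine Real.rpow_le_rpow_of_nonpos hx ?_ (by linarith)
      rw [numPoints_eq_ceil]
      exact Nat.le_ceil _
    have h2 : realPoints D β η C₃ ε L l ^ (-(2 * η)) =
        (K ^ 2)⁻¹ * meshSize l ^ (2 * β / (2 * η + 1) - 2 * β) *
          (D l : ℝ) ^ (2 * η / (2 * η + 1)) * (levelSum D β η L)⁻¹ := by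
      rw [realPoints, ← hK, Real.mul_rpow (by positivity) (by positivity),
        Real.mul_rpow (by positivity) (by positivity),
        Real.mul_rpow (by positivity) (by positivity), ← Real.rpow_mul hK0.le,
        ← Real.rpow_mul hm.le, ← Real.rpow_mul hd.le, ← Real.rpow_mul hS.le,
        show 1 / η * -(2 * η) = -2 by field_simp,
        show 1 / (2 * η) * -(2 * η) = -1 by field_simp,
        show 2 * β / (2 * η + 1) * -(2 * η) = 2 * β / (2 * η + 1) - 2 * β by field_simp; ring,
        show -1 / (2 * η + 1) * -(2 * η) = 2 * η / (2 * η + 1) by field_simp,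
        Real.rpow_neg hK0.le, Real.rpow_neg_one, Real.rpow_two]
    calc _ ≤ meshSize l ^ (2 * β) * realPoints D β η C₃ ε L l ^ (-(2 * η)) := by gcongr
      _ = (K ^ 2)⁻¹ * (levelSum D β η L)⁻¹ *
          (meshSize l ^ (2 * β) * meshSize l ^ (2 * β / (2 * η + 1) - 2 * β) *
            (D l : ℝ) ^ (2 * η / (2 * η + 1))) := by rw [h2]; ring
      _ = _ := by rw [← Real.rpow_add hm, add_sub_cancel]
  have hK2 : K ^ 2 = 2 * L * C₃ ^ 2 * (ε ^ 2)⁻¹ := by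
    rw [hK, mul_pow, Real.sq_sqrt (by positivity), inv_pow]
  calc _ ≤ C₃ ^ 2 * L * ∑ l ∈ Finset.range (L + 1), (K ^ 2)⁻¹ * (levelSum D β η L)⁻¹ *
        (meshSize l ^ (2 * β / (2 * η + 1)) * (D l : ℝ) ^ (2 * η / (2 * η + 1))) := by
        exact mul_le_mul_of_nonneg_left (Finset.sum_le_sum fun l _ => key l) (by positivity)
    _ = C₃ ^ 2 * L * ((K ^ 2)⁻¹ * (levelSum D β η L)⁻¹ * levelSum D β η L) := by
        rw [← Finset.mul_sum, ← levelSum]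
    _ = ε ^ 2 / 2 := by
        rw [inv_mul_cancel_right₀ hS.ne', hK2]
        field_simp

theorem sum_dim_mul_numPoints_bounds (hD : ∀ j, 0 < D j) (hη : 0 < η) (hL : 1 ≤ L)
    (hC₃ : 0 < C₃) (hε : 0 < ε) :
    (Real.sqrt (2 * L * C₃ ^ 2) * ε⁻¹) ^ (1 / η) * levelSum D β η L ^ (1 + 1 / (2 * η)) ≤
      ∑ l ∈ Finset.range (L + 1), (D l : ℝ) * numPoints D β η C₃ ε L l ∧
    ∑ l ∈ Finset.range (L + 1), (D l : ℝ) ≤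
      ∑ l ∈ Finset.range (L + 1), (D l : ℝ) * numPoints D β η C₃ ε L l ∧
    ∑ l ∈ Finset.range (L + 1), (D l : ℝ) * numPoints D β η C₃ ε L l ≤
      (Real.sqrt (2 * L * C₃ ^ 2) * ε⁻¹) ^ (1 / η) * levelSum D β η L ^ (1 + 1 / (2 * η)) +
        ∑ l ∈ Finset.range (L + 1), (D l : ℝ) := by
  have hx := fun l => realPoints_pos (β := β) (η := η) hD hL hC₃ hε l
  refine ⟨?_, ?_, ?_⟩
  · rw [← sum_dim_mul_realPoints hD hη]
    gcongr with l _
    exact Nat.le_ceil _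
  · refine Finset.sum_le_sum fun l _ => le_mul_of_one_le_right (Nat.cast_nonneg _) ?_
    exact_mod_cast Nat.one_le_ceil_iff.2 (hx l)
  · rw [← sum_dim_mul_realPoints hD hη, ← Finset.sum_add_distrib]
    refine Finset.sum_le_sum fun l _ => ?_
    rw [← mul_add_one]
    gcongr
    exact (Nat.ceil_lt_add_one (hx l).le).le

end Points

/-! ### The level as a function of the tolerance -/

theorem meshSize_rpow_eq (l : ℕ) (a : ℝ) : meshSize l ^ a = (2 : ℝ) ^ (-(a * l)) := by
  rw [meshSize, inv_pow, Real.inv_rpow (by positivity), ← Real.rpow_natCast,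
    ← Real.rpow_mul (by norm_num), Real.rpow_neg (by norm_num), mul_comm]

section Level

variable {α C₁ ε : ℝ}

theorem one_le_logb_inv (hε : 0 < ε) (hε' : ε ≤ 1 / 2) : 1 ≤ Real.logb 2 ε⁻¹ := by
  rw [Real.le_logb_iff_rpow_le (by norm_num) (by positivity), Real.rpow_one]
  rw [le_inv_comm₀ (by norm_num) hε]
  linarith

theorem logb_two_mul_inv (hC₁ : 1 / 2 ≤ C₁) (hε : 0 < ε) :
    Real.logb 2 (2 * C₁ * ε⁻¹) = Real.logb 2 (2 * C₁) + Real.logb 2 ε⁻¹ :=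
  Real.logb_mul (by linarith) (by positivity)

theorem logb_two_mul_nonneg (hC₁ : 1 / 2 ≤ C₁) : 0 ≤ Real.logb 2 (2 * C₁) :=
  Real.logb_nonneg (by norm_num) (by linarith)

theorem le_maxLevel (hα : 0 < α) (hC₁ : 1 / 2 ≤ C₁) (hε : 0 < ε) :
    1 / α * Real.logb 2 ε⁻¹ ≤ maxLevel α C₁ ε := by
  refine le_trans ?_ (Nat.le_ceil _)
  rw [logb_two_mul_inv hC₁ hε]
  gcongr
  linarith [logb_two_mul_nonneg hC₁]

theorem maxLevel_le (hα : 0 < α) (hC₁ : 1 / 2 ≤ C₁) (hε : 0 < ε) (hε' : ε ≤ 1 / 2) :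
    (maxLevel α C₁ ε : ℝ) ≤
      (1 / α * (Real.logb 2 (2 * C₁) + 1) + 1) * Real.logb 2 ε⁻¹ := by
  have h1 := one_le_logb_inv hε hε'
  have h2 := logb_two_mul_nonneg hC₁
  have h3 : (0 : ℝ) ≤ 1 / α := by positivity
  have h4 : 0 ≤ 1 / α * Real.logb 2 (2 * C₁ * ε⁻¹) := by
    rw [logb_two_mul_inv hC₁ hε]
    exact mul_nonneg h3 (by linarith)
  have h5 : (maxLevel α C₁ ε : ℝ) ≤ 1 / α * Real.logb 2 (2 * C₁ * ε⁻¹) + 1 :=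
    (Nat.ceil_lt_add_one h4).le
  rw [logb_two_mul_inv hC₁ hε] at h5
  refine h5.trans ?_
  nlinarith [mul_nonneg h3 h2, mul_nonneg (mul_nonneg h3 h2) (sub_nonneg.2 h1)]

theorem one_le_maxLevel (hα : 0 < α) (hC₁ : 1 / 2 ≤ C₁) (hε : 0 < ε) (hε' : ε ≤ 1 / 2) :
    1 ≤ maxLevel α C₁ ε := by
  have h1 := one_le_logb_inv hε hε'
  have h2 := le_maxLevel hα hC₁ hε
  have h3 : (0 : ℝ) < maxLevel α C₁ ε := lt_of_lt_of_le (by positivity) h2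
  exact_mod_cast h3

theorem le_two_rpow_maxLevel (hα : 0 < α) (hC₁ : 1 / 2 ≤ C₁) (hε : 0 < ε) :
    2 * C₁ * ε⁻¹ ≤ (2 : ℝ) ^ (α * maxLevel α C₁ ε) := by
  have h0 : 0 < 2 * C₁ * ε⁻¹ := mul_pos (by linarith) (inv_pos.2 hε)
  have h1 : 1 / α * Real.logb 2 (2 * C₁ * ε⁻¹) ≤ maxLevel α C₁ ε := Nat.le_ceil _
  rw [← Real.logb_le_iff_le_rpow (by norm_num) h0]
  rw [one_div, inv_mul_le_iff₀ hα] at h1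
  exact h1

theorem two_rpow_maxLevel_le (hα : 0 < α) (hC₁ : 1 / 2 ≤ C₁) (hε : 0 < ε) (hε' : ε ≤ 1 / 2) :
    (2 : ℝ) ^ (α * maxLevel α C₁ ε) ≤ 2 ^ α * (2 * C₁ * ε⁻¹) := by
  have h0 : 0 < 2 * C₁ * ε⁻¹ := mul_pos (by linarith) (inv_pos.2 hε)
  have h4 : 0 ≤ 1 / α * Real.logb 2 (2 * C₁ * ε⁻¹) := by
    rw [logb_two_mul_inv hC₁ hε]
    exact mul_nonneg (by positivity)
      (by linarith [one_le_logb_inv hε hε', logb_two_mul_nonneg hC₁])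
  have h5 : (maxLevel α C₁ ε : ℝ) ≤ 1 / α * Real.logb 2 (2 * C₁ * ε⁻¹) + 1 :=
    (Nat.ceil_lt_add_one h4).le
  calc (2 : ℝ) ^ (α * maxLevel α C₁ ε)
      ≤ 2 ^ (α + Real.logb 2 (2 * C₁ * ε⁻¹)) := by
        refine Real.rpow_le_rpow_of_exponent_le (by norm_num) ?_
        calc α * maxLevel α C₁ ε ≤ α * (1 / α * Real.logb 2 (2 * C₁ * ε⁻¹) + 1) := by gcongr
          _ = _ := by field_simp; ring
    _ = _ := by
        rw [Real.rpow_add (by norm_num), Real.rpow_logb (by norm_num) (by norm_num) h0]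

theorem bias_maxLevel_le (hα : 0 < α) (hC₁ : 1 / 2 ≤ C₁) (hε : 0 < ε) :
    2 * C₁ ^ 2 * meshSize (maxLevel α C₁ ε) ^ (2 * α) ≤ ε ^ 2 / 2 := by
  have hC : 0 < C₁ := by linarith
  have h1 : meshSize (maxLevel α C₁ ε) ^ α ≤ ε / (2 * C₁) := by
    rw [meshSize_rpow_eq, Real.rpow_neg (by norm_num)]
    refine (inv_anti₀ (by positivity) (le_two_rpow_maxLevel hα hC₁ hε)).trans_eq ?_
    rw [mul_inv, inv_inv]; ring
  have h0 : 0 ≤ meshSize (maxLevel α C₁ ε) ^ α := Real.rpow_nonneg (meshSize_pos _).le _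
  rw [← meshSize_rpow_sq]
  calc _ ≤ 2 * C₁ ^ 2 * (ε / (2 * C₁)) ^ 2 := by gcongr
    _ = _ := by field_simp

end Level

/-! ### Asymptotic cost -/

/-- `f ∼ g` for `ε ∈ (0, 1/2]`: two-sided bounds with positive constants, for a nonnegative
reference function `g`. -/
def Comparable (f g : ℝ → ℝ) : Prop :=
  ∃ c c' : ℝ, 0 < c ∧ 0 < c' ∧ ∀ ε : ℝ, 0 < ε → ε ≤ 1 / 2 →
    0 ≤ g ε ∧ c * g ε ≤ f ε ∧ f ε ≤ c' * g ε

namespace Comparable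

variable {f g f₁ f₂ g₁ g₂ h : ℝ → ℝ}

theorem trans (hfg : Comparable f g) (hgh : Comparable g h) : Comparable f h := by
  obtain ⟨a, a', ha, ha', H⟩ := hfg
  obtain ⟨b, b', hb, hb', H'⟩ := hgh
  refine ⟨a * b, a' * b', by positivity, by positivity, fun ε h1 h2 => ?_⟩
  obtain ⟨_, h4, h5⟩ := H ε h1 h2
  obtain ⟨h6, h7, h8⟩ := H' ε h1 h2
  refine ⟨h6, ?_, ?_⟩
  · rw [mul_assoc]; exact (mul_le_mul_of_nonneg_left h7 ha.le).trans h4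
  · rw [mul_assoc]; exact h5.trans (mul_le_mul_of_nonneg_left h8 ha'.le)

theorem refl (hf : ∀ ε, 0 < ε → ε ≤ 1 / 2 → 0 ≤ f ε) : Comparable f f :=
  ⟨1, 1, one_pos, one_pos, fun ε h1 h2 => ⟨hf ε h1 h2, by rw [one_mul], by rw [one_mul]⟩⟩

theorem congr_right (hf : Comparable f g) (hg : ∀ ε, 0 < ε → ε ≤ 1 / 2 → g ε = h ε) :
    Comparable f h := by
  obtain ⟨a, a', ha, ha', H⟩ := hf
  exact ⟨a, a', ha, ha', fun ε h1 h2 => hg ε h1 h2 ▸ H ε h1 h2⟩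

theorem add (h₁ : Comparable f₁ g₁) (h₂ : Comparable f₂ g₂) :
    Comparable (fun ε => f₁ ε + f₂ ε) (fun ε => g₁ ε + g₂ ε) := by
  obtain ⟨a, a', ha, ha', H⟩ := h₁
  obtain ⟨b, b', hb, hb', H'⟩ := h₂
  refine ⟨min a b, max a' b', lt_min ha hb, lt_max_of_lt_left ha', fun ε h1 h2 => ?_⟩
  obtain ⟨h3, h4, h5⟩ := H ε h1 h2
  obtain ⟨h6, h7, h8⟩ := H' ε h1 h2
  refine ⟨add_nonneg h3 h6, ?_, ?_⟩
  · rw [mul_add]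
    exact add_le_add ((mul_le_mul_of_nonneg_right (min_le_left _ _) h3).trans h4)
      ((mul_le_mul_of_nonneg_right (min_le_right _ _) h6).trans h7)
  · rw [mul_add]
    exact add_le_add (h5.trans (mul_le_mul_of_nonneg_right (le_max_left _ _) h3))
      (h8.trans (mul_le_mul_of_nonneg_right (le_max_right _ _) h6))

theorem mul (h₁ : Comparable f₁ g₁) (h₂ : Comparable f₂ g₂) :
    Comparable (fun ε => f₁ ε * f₂ ε) (fun ε => g₁ ε * g₂ ε) := by
  obtain ⟨a, a', ha, ha', H⟩ := h₁
  obtain ⟨b, b', hb, hb', H'⟩ := h₂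
  refine ⟨a * b, a' * b', by positivity, by positivity, fun ε h1 h2 => ?_⟩
  obtain ⟨h3, h4, h5⟩ := H ε h1 h2
  obtain ⟨h6, h7, h8⟩ := H' ε h1 h2
  refine ⟨mul_nonneg h3 h6, ?_, ?_⟩
  · rw [mul_mul_mul_comm]
    exact mul_le_mul h4 h7 (by positivity) ((by positivity : 0 ≤ a * g₁ ε).trans h4)
  · rw [mul_mul_mul_comm a']
    exact mul_le_mul h5 h8 ((by positivity : 0 ≤ b * g₂ ε).trans h7) (by positivity)

theorem rpow (h₁ : Comparable f g) {s : ℝ} (hs : 0 ≤ s) :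
    Comparable (fun ε => f ε ^ s) (fun ε => g ε ^ s) := by
  obtain ⟨a, a', ha, ha', H⟩ := h₁
  refine ⟨a ^ s, a' ^ s, by positivity, by positivity, fun ε h1 h2 => ?_⟩
  obtain ⟨h3, h4, h5⟩ := H ε h1 h2
  have h6 : 0 ≤ a * g ε := by positivity
  refine ⟨Real.rpow_nonneg h3 s, ?_, ?_⟩
  · rw [← Real.mul_rpow ha.le h3]; exact Real.rpow_le_rpow h6 h4 hs
  · rw [← Real.mul_rpow ha'.le h3]; exact Real.rpow_le_rpow (h6.trans h4) h5 hs

end Comparable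

section Rates

variable {α C₁ : ℝ}

theorem comparable_maxLevel (hα : 0 < α) (hC₁ : 1 / 2 ≤ C₁) :
    Comparable (fun ε => (maxLevel α C₁ ε : ℝ)) fun ε => |Real.logb 2 ε⁻¹| := by
  have h0 := logb_two_mul_nonneg hC₁
  refine ⟨1 / α, 1 / α * (Real.logb 2 (2 * C₁) + 1) + 1, by positivity, by positivity,
    fun ε h1 h2 => ⟨abs_nonneg _, ?_⟩⟩
  have h3 := one_le_logb_inv h1 h2
  dsimp only
  rw [abs_of_nonneg (by linarith)]
  exact ⟨le_maxLevel hα hC₁ h1, maxLevel_le hα hC₁ h1 h2⟩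

theorem comparable_two_rpow_maxLevel (hα : 0 < α) (hC₁ : 1 / 2 ≤ C₁) {t : ℝ} (ht : 0 ≤ t) :
    Comparable (fun ε => (2 : ℝ) ^ (t * maxLevel α C₁ ε)) fun ε => ε ^ (-(t / α)) := by
  have hC : 0 < C₁ := by linarith
  have h : Comparable (fun ε => (2 : ℝ) ^ (α * maxLevel α C₁ ε)) fun ε => ε⁻¹ := by
    refine ⟨2 * C₁, 2 ^ α * (2 * C₁), by positivity, by positivity, fun ε h1 h2 =>
      ⟨by positivity, le_two_rpow_maxLevel hα hC₁ h1, ?_⟩⟩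
    rw [mul_assoc]
    exact two_rpow_maxLevel_le hα hC₁ h1 h2
  have h' := h.rpow (div_nonneg ht hα.le)
  have e : (fun ε => (2 : ℝ) ^ (t * maxLevel α C₁ ε)) =
      fun ε => ((2 : ℝ) ^ (α * maxLevel α C₁ ε)) ^ (t / α) := by
    funext ε
    rw [← Real.rpow_mul (by norm_num)]
    congr 1
    field_simp
  rw [e]
  exact h'.congr_right fun ε h1 _ => by rw [Real.rpow_neg h1.le, Real.inv_rpow h1.le]

theorem geom_sum_le_of_one_lt {r : ℝ} (hr : 1 < r) (L : ℕ) :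
    ∑ j ∈ Finset.range (L + 1), r ^ j ≤ r / (r - 1) * r ^ L := by
  rw [geom_sum_eq hr.ne', div_mul_eq_mul_div, ← pow_succ']
  have : 0 < r - 1 := by linarith
  gcongr
  linarith

theorem geom_sum_le_of_lt_one {r : ℝ} (hr0 : 0 < r) (hr : r < 1) (L : ℕ) :
    ∑ j ∈ Finset.range (L + 1), r ^ j ≤ 1 / (1 - r) := by
  have h1 : 0 < 1 - r := by linarith
  rw [geom_sum_eq hr.ne, ← neg_div_neg_eq, neg_sub, neg_sub]
  gcongr
  have := pow_pos hr0 (L + 1)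
  linarith

/-- The dimensions grow geometrically, so that their sum is dominated by the finest level. -/
theorem comparable_sum_dim (hα : 0 < α) (hC₁ : 1 / 2 ≤ C₁) {d : ℕ} (hd : 1 ≤ d) :
    Comparable (fun ε => ∑ l ∈ Finset.range (maxLevel α C₁ ε + 1), ((2 ^ (d * l) : ℕ) : ℝ))
      fun ε => ε ^ (-(d / α)) := by
  refine Comparable.trans ?_ (comparable_two_rpow_maxLevel hα hC₁ (Nat.cast_nonneg d))
  have hr : (1 : ℝ) < 2 ^ d := one_lt_pow₀ (by norm_num) (by omega)
  refine ⟨1, (2 ^ d) / (2 ^ d - 1), one_pos, div_pos (by positivity) (by linarith),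
    fun ε _ _ => ⟨by positivity, ?_⟩⟩
  have e1 : (2 : ℝ) ^ ((d : ℝ) * maxLevel α C₁ ε) = (2 ^ d) ^ maxLevel α C₁ ε := by
    rw [Real.rpow_mul (by norm_num), Real.rpow_natCast, Real.rpow_natCast]
  have e2 : ∀ l, ((2 ^ (d * l) : ℕ) : ℝ) = (2 ^ d) ^ l := fun l => by
    push_cast; rw [pow_mul]
  simp only [e1, e2, one_mul]
  exact ⟨Finset.single_le_sum (f := fun l => ((2 : ℝ) ^ d) ^ l) (fun l _ => by positivity)
    (Finset.self_mem_range_succ _), geom_sum_le_of_one_lt hr _⟩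

variable {β η : ℝ} {d : ℕ}

theorem levelSum_two_pow (hη : 0 < η) (L : ℕ) :
    levelSum (fun j => 2 ^ (d * j)) β η L =
      ∑ j ∈ Finset.range (L + 1), ((2 : ℝ) ^ ((2 * η * d - 2 * β) / (2 * η + 1))) ^ j := by
  refine Finset.sum_congr rfl fun j _ => ?_
  have e : ((2 ^ (d * j) : ℕ) : ℝ) = (2 : ℝ) ^ ((d : ℝ) * j) := by
    rw [← Nat.cast_mul, Real.rpow_natCast]; push_cast; rfl
  rw [meshSize_rpow_eq, e, ← Real.rpow_mul (by norm_num), ← Real.rpow_add (by norm_num),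
    ← Real.rpow_natCast, ← Real.rpow_mul (by norm_num)]
  congr 1
  field_simp
  ring

/-- A convergent geometric sum. -/
theorem comparable_levelSum_of_lt (hη : 0 < η) (h : η * d < β) :
    Comparable (fun ε => levelSum (fun j => 2 ^ (d * j)) β η (maxLevel α C₁ ε)) fun _ => 1 := by
  simp only [levelSum_two_pow hη]
  set r : ℝ := (2 : ℝ) ^ ((2 * η * d - 2 * β) / (2 * η + 1)) with hr
  have hr0 : 0 < r := by positivity
  have hr1 : r < 1 := Real.rpow_lt_one_of_one_lt_of_neg (by norm_num)
    (div_neg_of_neg_of_pos (by linarith) (by linarith))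
  refine ⟨1, 1 / (1 - r), one_pos, one_div_pos.2 (by linarith), fun ε _ _ =>
    ⟨zero_le_one, ?_, ?_⟩⟩
  · rw [one_mul]
    simpa using Finset.single_le_sum (f := fun l => r ^ l) (fun l _ => by positivity)
      (Finset.mem_range.2 (Nat.succ_pos (maxLevel α C₁ ε)))
  · rw [mul_one]
    exact geom_sum_le_of_lt_one hr0 hr1 _

/-- All summands are equal to one. -/
theorem comparable_levelSum_of_eq (hα : 0 < α) (hC₁ : 1 / 2 ≤ C₁) (hη : 0 < η) (h : β = η * d) :
    Comparable (fun ε => levelSum (fun j => 2 ^ (d * j)) β η (maxLevel α C₁ ε))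
      fun ε => |Real.logb 2 ε⁻¹| := by
  refine Comparable.trans ?_ (comparable_maxLevel hα hC₁)
  refine ⟨1, 2, one_pos, two_pos, fun ε h1 h2 => ⟨Nat.cast_nonneg _, ?_⟩⟩
  have h3 : (1 : ℝ) ≤ maxLevel α C₁ ε := by exact_mod_cast one_le_maxLevel hα hC₁ h1 h2
  have e : levelSum (fun j => 2 ^ (d * j)) β η (maxLevel α C₁ ε) = maxLevel α C₁ ε + 1 := by
    rw [levelSum_two_pow hη, h, show 2 * η * d - 2 * (η * d) = 0 by ring]
    simp
  dsimp only
  rw [e]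
  constructor <;> linarith

/-- A geometric sum that is dominated by its last term. -/
theorem comparable_levelSum_of_gt (hα : 0 < α) (hC₁ : 1 / 2 ≤ C₁) (hη : 0 < η) (h : β < η * d) :
    Comparable (fun ε => levelSum (fun j => 2 ^ (d * j)) β η (maxLevel α C₁ ε))
      fun ε => ε ^ (-((2 * η * d - 2 * β) / (2 * η + 1) / α)) := by
  have ht : 0 < (2 * η * d - 2 * β) / (2 * η + 1) := div_pos (by linarith) (by linarith)
  refine Comparable.trans ?_ (comparable_two_rpow_maxLevel hα hC₁ ht.le)
  simp only [levelSum_two_pow hη]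
  set r : ℝ := (2 : ℝ) ^ ((2 * η * d - 2 * β) / (2 * η + 1)) with hr
  have hr1 : 1 < r := Real.one_lt_rpow (by norm_num) ht
  have hr0 : 0 < r := by positivity
  refine ⟨1, r / (r - 1), one_pos, div_pos hr0 (by linarith), fun ε _ _ => ?_⟩
  have e1 : (2 : ℝ) ^ ((2 * η * d - 2 * β) / (2 * η + 1) * maxLevel α C₁ ε) =
      r ^ maxLevel α C₁ ε := by
    rw [Real.rpow_mul (by norm_num), Real.rpow_natCast]
  dsimp only
  rw [e1, one_mul]
  exact ⟨by positivity, Finset.single_le_sum (f := fun l => r ^ l) (fun l _ => by positivity)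
    (Finset.self_mem_range_succ _), geom_sum_le_of_one_lt hr1 _⟩

theorem comparable_prefactor (hα : 0 < α) (hC₁ : 1 / 2 ≤ C₁) (hη : 0 < η) {C₃ : ℝ}
    (hC₃ : 0 < C₃) :
    Comparable (fun ε => (Real.sqrt (2 * maxLevel α C₁ ε * C₃ ^ 2) * ε⁻¹) ^ (1 / η))
      fun ε => ε ^ (-(1 / η)) * |Real.logb 2 ε⁻¹| ^ (1 / (2 * η)) := by
  have h1 : Comparable (fun ε => 2 * (maxLevel α C₁ ε : ℝ) * C₃ ^ 2)
      fun ε => |Real.logb 2 ε⁻¹| := by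
    refine Comparable.trans ?_ (comparable_maxLevel hα hC₁)
    exact ⟨2 * C₃ ^ 2, 2 * C₃ ^ 2, by positivity, by positivity, fun ε _ _ =>
      ⟨by positivity, (by ring_nf; rfl), (by ring_nf; rfl)⟩⟩
  have h2 := ((h1.rpow (s := 1 / 2) (by norm_num)).mul (Comparable.refl (f := fun ε => ε⁻¹)
    fun ε h _ => by positivity)).rpow (s := 1 / η) (by positivity)
  simp only [← Real.sqrt_eq_rpow] at h2
  refine h2.congr_right fun ε h _ => ?_
  rw [Real.mul_rpow (Real.sqrt_nonneg _) (by positivity), Real.sqrt_eq_rpow,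
    ← Real.rpow_mul (abs_nonneg _), Real.inv_rpow h.le, ← Real.rpow_neg h.le, mul_comm,
    show 1 / 2 * (1 / η) = 1 / (2 * η) by field_simp]

/-- The asymptotic cost of the multilevel method with the optimal numbers of points. -/
theorem comparable_complexityRate (hα : 0 < α) (hC₁ : 1 / 2 ≤ C₁) (hη : 0 < η) (hd : 1 ≤ d)
    {C₃ : ℝ} (hC₃ : 0 < C₃) :
    Comparable (fun ε => ∑ l ∈ Finset.range (maxLevel α C₁ ε + 1), ((2 ^ (d * l) : ℕ) : ℝ) *
      numPoints (fun j => 2 ^ (d * j)) β η C₃ ε (maxLevel α C₁ ε) l)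
      (complexityRate d α β η) := by
  let V : ℝ → ℝ := fun ε => (Real.sqrt (2 * maxLevel α C₁ ε * C₃ ^ 2) * ε⁻¹) ^ (1 / η) *
    levelSum (fun j => 2 ^ (d * j)) β η (maxLevel α C₁ ε) ^ (1 + 1 / (2 * η))
  let T : ℝ → ℝ := fun ε => ∑ l ∈ Finset.range (maxLevel α C₁ ε + 1), ((2 ^ (d * l) : ℕ) : ℝ)
  have hD : ∀ j, 0 < (fun j => 2 ^ (d * j) : ℕ → ℕ) j := fun j => by positivity
  have h1 : Comparable (fun ε => ∑ l ∈ Finset.range (maxLevel α C₁ ε + 1),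
      ((2 ^ (d * l) : ℕ) : ℝ) * numPoints (fun j => 2 ^ (d * j)) β η C₃ ε (maxLevel α C₁ ε) l)
      (fun ε => T ε + V ε) := by
    refine ⟨1 / 2, 1, by norm_num, one_pos, fun ε h h' => ?_⟩
    obtain ⟨b1, b2, b3⟩ := sum_dim_mul_numPoints_bounds (β := β) hD hη
      (one_le_maxLevel hα hC₁ h h') hC₃ h
    have hS := levelSum_pos (β := β) (η := η) (L := maxLevel α C₁ ε) hD
    have hV : 0 ≤ V ε := by positivity
    have hT : 0 ≤ T ε := by positivity
    refine ⟨add_nonneg hT hV, ?_, ?_⟩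
    · simp only [T, V] at *; linarith
    · simp only [T, V] at *; linarith
  refine h1.trans ?_
  have hT : Comparable T fun ε => ε ^ (-(d / α)) := comparable_sum_dim hα hC₁ hd
  have hK := comparable_prefactor hα hC₁ hη hC₃
  have hs : 0 ≤ 1 + 1 / (2 * η) := by positivity
  rcases lt_trichotomy (η * d) β with h | h | h
  · refine (hT.add (hK.mul ((comparable_levelSum_of_lt hη h).rpow hs))).congr_right
      fun ε _ _ => ?_
    rw [complexityRate, if_pos h, Real.one_rpow, mul_one]
  · refine (hT.add (hK.mul ((comparable_levelSum_of_eq hα hC₁ hη h.symm).rpow hs))).congr_right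
      fun ε h0 h2 => ?_
    have h3 := one_le_logb_inv h0 h2
    have h4 : 0 < |Real.logb 2 ε⁻¹| := by rw [abs_of_nonneg] <;> linarith
    rw [complexityRate, if_neg h.not_lt, if_pos h.symm, mul_assoc, ← Real.rpow_add h4,
      show 1 / (2 * η) + (1 + 1 / (2 * η)) = 1 + 1 / η by field_simp; ring]
  · refine (hT.add (hK.mul ((comparable_levelSum_of_gt hα hC₁ hη h).rpow hs))).congr_right
      fun ε h0 _ => ?_
    rw [complexityRate, if_neg h.not_gt, if_neg h.ne, ← Real.rpow_mul h0.le, mul_right_comm,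
      ← Real.rpow_add h0]
    congr 3
    field_simp
    ring

end Rates

/-- The work is comparable to `∑ dim V_l N_l`, the problems on the coarser of two levels being
cheaper. -/
theorem multilevelWork_bounds {cost : ℕ → ℕ → ℝ} {D : ℕ → ℕ} (hD : Monotone D) {κ₁ κ₂ : ℝ}
    (hκ₁ : 0 ≤ κ₁) (hκ₂ : 0 ≤ κ₂)
    (hcost : ∀ l N : ℕ, κ₁ * (D l * N) ≤ cost l N ∧ cost l N ≤ κ₂ * (D l * N)) {n N : ℕ → ℕ}
    {L : ℕ} (hn : ∀ l ≤ L, n (L - l) = N l) :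
    κ₁ * ∑ l ∈ Finset.range (L + 1), (D l : ℝ) * N l ≤ multilevelWork cost n L ∧
      multilevelWork cost n L ≤ 2 * κ₂ * ∑ l ∈ Finset.range (L + 1), (D l : ℝ) * N l := by
  have e : multilevelWork cost n L = cost 0 (N 0) + ∑ i ∈ Finset.range L,
      (cost i (N (i + 1)) + cost (i + 1) (N (i + 1))) := by
    rw [multilevelWork, sum_Icc_one_eq_sum_range, ← hn 0 (Nat.zero_le _), Nat.sub_zero]
    congr 1
    refine Finset.sum_congr rfl fun i hi => ?_
    rw [hn (i + 1) (Finset.mem_range.1 hi), Nat.add_sub_cancel]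
  rw [e, Finset.sum_range_succ', mul_add, mul_add, Finset.mul_sum, Finset.mul_sum,
    add_comm (cost 0 (N 0))]
  have h0 : ∀ i, (0 : ℝ) ≤ D i * N i := fun i => by positivity
  constructor
  · refine add_le_add (Finset.sum_le_sum fun i _ => ?_) (hcost 0 (N 0)).1
    have h1 := (hcost i (N (i + 1))).1
    have h2 := (hcost (i + 1) (N (i + 1))).1
    have h3 : 0 ≤ κ₁ * (D i * N (i + 1)) := by positivity
    linarith
  · refine add_le_add (Finset.sum_le_sum fun i _ => ?_) ?_
    · have h1 := (hcost i (N (i + 1))).2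
      have h2 := (hcost (i + 1) (N (i + 1))).2
      have h3 : κ₂ * (D i * N (i + 1)) ≤ κ₂ * (D (i + 1) * N (i + 1)) := by
        have : D i ≤ D (i + 1) := hD (Nat.le_succ i)
        gcongr
      linarith
    · have h1 := (hcost 0 (N 0)).2
      have h3 : 0 ≤ κ₂ * (D 0 * N 0) := by positivity
      linarith

theorem mainTheorem3 {Ω U V H Z W : Type*} [MeasurableSpace Ω]
    [NormedAddCommGroup U] [InnerProductSpace ℝ U] [CompleteSpace U]
    [NormedAddCommGroup V] [InnerProductSpace ℝ V] [CompleteSpace V]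
    [NormedAddCommGroup H] [InnerProductSpace ℝ H] [CompleteSpace H]
    [NormedAddCommGroup Z] [InnerProductSpace ℝ Z] [CompleteSpace Z]
    [NormedAddCommGroup W] [InnerProductSpace ℝ W] [CompleteSpace W]
    (μ : Measure Ω) [IsProbabilityMeasure μ]
    (P : ControlProblem Ω U V H Z W) (hP : P.WellPosed μ)
    -- spatial discretization
    (d : ℕ) (hd : 1 ≤ d) (Vh : ℕ → Submodule ℝ V)
    (hdim : ∀ l, Module.finrank ℝ (Vh l) = 2 ^ (d * l))
    (αW αZ α' α β : ℝ) (hαW : 0 < αW) (hαZ : 0 < αZ) (hα' : 0 < α')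
    (hα : α = min αW αZ) (hβ : β = min α α')
    (hFEM : P.FEMAssumption μ Vh αW αZ)
    -- function spaces for the quadrature, with the constants of the quadrature assumption (`Cq`)
    -- and of the mixed-regularity assumption (`CH`)
    (Hq : ℝ → IntegrandSpace μ Z) (Cq CH : ℝ → ℝ) (qbar : ℝ) (hqbar : 2 < qbar)
    (hmix : P.MixedRegularity μ Vh Hq CH qbar α')
    (η : ℝ) (hη : 0 < η)
    -- the cost of one minimization is proportional to `dim V_ℓ * N`
    (cost : ℕ → ℕ → ℝ) (κ₁ κ₂ : ℝ) (hκ₁ : 0 < κ₁)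
    (hcost : ∀ l N : ℕ, κ₁ * (Module.finrank ℝ (Vh l) * N) ≤ cost l N ∧
      cost l N ≤ κ₂ * (Module.finrank ℝ (Vh l) * N)) :
    ∃ C₁₀ C₃₀ : ℝ, 0 < C₁₀ ∧ 0 < C₃₀ ∧ ∀ C₁ C₃ : ℝ, C₁₀ ≤ C₁ → C₃₀ ≤ C₃ →
      -- the error bound, in which the constants `C₁`, `C₃` appear
      (∀ (Θ : Type*) [MeasurableSpace Θ] (ρ : Measure Θ) [IsProbabilityMeasure ρ]
        (Q : ℕ → RandomizedQuadrature Ω Θ),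
        QuadratureAssumption μ ρ Hq Cq (fun k => ((Q k).n : ℝ) ^ (-η)) Q →
        ∀ L : ℕ, 1 ≤ L →
          Integrable (fun θ => ‖P.optControl μ ⊤ - P.multilevelControl Vh Q L θ‖ ^ 2) ρ ∧
          ∫ θ, ‖P.optControl μ ⊤ - P.multilevelControl Vh Q L θ‖ ^ 2 ∂ρ ≤
            2 * C₁ ^ 2 * meshSize L ^ (2 * α) +
              C₃ ^ 2 * L * ∑ l ∈ Finset.range (L + 1),
                meshSize l ^ (2 * β) * (((Q (L - l)).n : ℝ) ^ (-η)) ^ 2) ∧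
      -- the complexity
      ∃ c c' : ℝ, 0 < c ∧ 0 < c' ∧ ∀ ε : ℝ, 0 < ε → ε ≤ 1 / 2 →
        ∀ L : ℕ, L = maxLevel α C₁ ε →
        ∀ (Θ : Type*) [MeasurableSpace Θ] (ρ : Measure Θ) [IsProbabilityMeasure ρ]
          (Q : ℕ → RandomizedQuadrature Ω Θ),
          QuadratureAssumption μ ρ Hq Cq (fun k => ((Q k).n : ℝ) ^ (-η)) Q →
          (∀ l ≤ L, (Q (L - l)).n =
            numPoints (fun j => Module.finrank ℝ (Vh j)) β η C₃ ε L l) →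
          Integrable (fun θ => ‖P.optControl μ ⊤ - P.multilevelControl Vh Q L θ‖ ^ 2) ρ ∧
          ∫ θ, ‖P.optControl μ ⊤ - P.multilevelControl Vh Q L θ‖ ^ 2 ∂ρ ≤ ε ^ 2 ∧
          c * complexityRate d α β η ε ≤ multilevelWork cost (fun k => (Q k).n) L ∧
          multilevelWork cost (fun k => (Q k).n) L ≤ c' * complexityRate d α β η ε := by
  subst hα hβ
  have : ∀ l, FiniteDimensional ℝ (Vh l) := fun l =>
    Module.finite_of_finrank_pos (by rw [hdim]; positivity)
  have hα0 : 0 < min αW αZ := lt_min hαW hαZ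
  -- The two quantifications over `Θ` live in different universes, hence the two applications.
  obtain ⟨A₁, A₃, hA₁, hA₃, hA⟩ :=
    ControlProblem.exists_multilevel_error_le hP hα0.le hα'.le hFEM hqbar hmix Cq
  obtain ⟨B₁, B₃, hB₁, hB₃, hB⟩ :=
    ControlProblem.exists_multilevel_error_le hP hα0.le hα'.le hFEM hqbar hmix Cq
  refine ⟨A₁ + B₁ + 1, A₃ + B₃ + 1, by positivity, by positivity, fun C₁ C₃ hC₁ hC₃ => ⟨?_, ?_⟩⟩
  · intro Θ _ ρ _ Q hQ L hL
    exact hA C₁ C₃ (by linarith) (by linarith) Θ ρ _ Q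
      (fun k => Real.rpow_nonneg (Nat.cast_nonneg _) _) hQ L hL
  have hC₁' : 1 / 2 ≤ C₁ := by linarith
  have hC₃' : 0 < C₃ := by linarith
  have hκ₂ : 0 < κ₂ := by
    have h1 := (hcost 0 1).1.trans (hcost 0 1).2
    rw [hdim] at h1
    norm_num at h1
    linarith
  obtain ⟨c, c', hc, hc', hrate⟩ := comparable_complexityRate (α := min αW αZ)
    (β := min (min αW αZ) α') hα0 hC₁' hη hd hC₃'
  refine ⟨κ₁ * c, 2 * κ₂ * c', by positivity, by positivity, ?_⟩
  rintro ε hε hε' L rfl Θ _ ρ _ Q hQ hn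
  obtain ⟨hint, herr⟩ := hB C₁ C₃ (by linarith) (by linarith) Θ ρ _ Q
    (fun k => Real.rpow_nonneg (Nat.cast_nonneg _) _) hQ _ (one_le_maxLevel hα0 hC₁' hε hε')
  simp only [hdim] at hn hcost
  have hD : ∀ j, 0 < (fun j => 2 ^ (d * j) : ℕ → ℕ) j := fun j => by positivity
  refine ⟨hint, herr.trans ?_, ?_⟩
  · have h1 := stochastic_error_numPoints_le (β := min (min αW αZ) α') hD hη
      (one_le_maxLevel hα0 hC₁' hε hε') hC₃' hε
    have h2 := fun l (hl : l ∈ Finset.range (maxLevel (min αW αZ) C₁ ε + 1)) =>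
      congrArg (fun N : ℕ => meshSize l ^ (2 * min (min αW αZ) α') * ((N : ℝ) ^ (-η)) ^ 2)
        (hn l (Nat.lt_succ_iff.1 (Finset.mem_range.1 hl)))
    rw [← Finset.sum_congr rfl h2] at h1
    linarith [bias_maxLevel_le hα0 hC₁' hε]
  · obtain ⟨_, h1, h2⟩ := hrate ε hε hε'
    obtain ⟨h3, h4⟩ := multilevelWork_bounds (D := fun j => 2 ^ (d * j))
      (n := fun k => (Q k).n) (fun i j h => Nat.pow_le_pow_right two_pos (Nat.mul_le_mul_left d h)) hκ₁.le hκ₂.le hcost hn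
    rw [mul_assoc, mul_assoc (2 * κ₂)]
    exact ⟨(mul_le_mul_of_nonneg_left h1 hκ₁.le).trans h3,
      h4.trans (mul_le_mul_of_nonneg_left h2 (by positivity))⟩
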